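/- Let $b\ge 2$ be an integer and $\omega_b=\exp(2\pi\sqrt{-1}/b)$. Write a nonnegative integer $k$ in base $b$ as $k=\kappa_1b^{a_1-1}+\dots+\kappa_vb^{a_v-1}$ with integers $0<\kappa_i\le b-1$ and $a_1>\dots>a_v\ge 1$ (with $v=0$ for $k=0$). Put $v(k):=v$ and, for an integer $\alpha\ge 0$, $\mu_\alpha(k):=a_1+\dots+a_{\min(\alpha,v)}$ (an empty sum is $0$). For $x\in[0,1)$ with $b$-adic expansion $x=\xi_1b^{-1}+\xi_2b^{-2}+\cdots$, in which infinitely many digits differ from $b-1$, let $\mathrm{wal}_k(x):=\omega_b^{\sum_{i=1}^{v}\kappa_i\xi_{a_i}}$. For $\boldsymbol k=(k_1,\dots,k_s)$ with nonnegative integers $k_j$ let $\mathrm{wal}_{\boldsymbol k}(\boldsymbol x):=\prod_{j=1}^s\mathrm{wal}_{k_j}(x_j)$ and $$\widehat f(\boldsymbol k):=\int_{[0,1)^s}f(\boldsymbol x)\,\overline{\mathrm{wal}_{\boldsymbol k}(\boldsymbol x)}\,d\boldsymbol x .$$ Let $m_b:=\min_{1\le c\le b-1}|1-\omega_b^{-c}|=2\sin(\pi/b)$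 and $M_b:=\max_{1\le c\le b-1}|1-\omega_b^{-c}|$. **Theorem.** Let $\alpha_1,\dots,\alpha_s$ be nonnegative integers and let $f\colon[0,1]^s\to\mathbb R$ have continuous mixed partial derivatives up to order $\alpha_j$ in each variable $x_j$; that is, $f^{(i_1,\dots,i_s)}:=(\partial/\partial x_1)^{i_1}\cdots(\partial/\partial x_s)^{i_s}f$ exists and is continuous on $[0,1]^s$ whenever $0\le i_j\le\alpha_j$ for all $j$ (derivatives being one-sided at the boundary). Let $\boldsymbol k=(k_1,\dots,k_s)$ be a vector of nonnegative integers and $n_j:=\min(\alpha_j,v(k_j))$ for $1\le j\le s$. If $b>2$, then $$|\widehat f(\boldsymbol k)|\le\|f^{(n_1,\dots,n_s)}\|_{L^1([0,1]^s)}\prod_{j=1}^s\frac{b^{-\mu_{\alpha_j}(k_j)}}{m_b^{\,n_j}}\left(M_b+\frac{b\,m_b}{b-M_b}\left(1-\Big(\frac{M_b}{b}\Big)^{n_j}\right)\right)^{\min(1,v(k_j))}.$$ If $b=2$, then for every $1\le p\le\infty$ (with $1/\infty=0$) $$|\widehat f(\boldsymbol k)|\le\|f^{(n_1,\dots,n_s)}\|_{L^p([0,1]^s)}\prod_{j=1}^s2^{-\mu_{\alpha_j}(k_j)-n_j+\min(1,v(k_j))/p}.$$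 -/

import Mathlib

open MeasureTheory
open scoped ENNReal ComplexConjugate

noncomputable section

namespace Walsh

/-- The positions `a₁ > a₂ > ⋯ > a_v ≥ 1` of the non-zero digits of `k` in base `b`, in decreasing
order, where `k = κ₁ b ^ (a₁ - 1) + ⋯ + κ_v b ^ (a_v - 1)` with `0 < κᵢ < b`. -/
def positions (b k : ℕ) : List ℕ :=
  (((List.range (Nat.digits b k).length).filter
    (fun i => (Nat.digits b k).getD i 0 ≠ 0)).map (fun i => i + 1)).reverse

/-- The Hamming weight `v(k)`: the number of non-zero digits of `k` in base `b`. -/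
def weight (b k : ℕ) : ℕ := (positions b k).length

/-- `μ_α(k) = a₁ + ⋯ + a_{min(α, v)}`. -/
def mu (b α k : ℕ) : ℕ := ((positions b k).take α).sum

/-- The primitive root of unity `ω_b = exp(2πi / b)`. -/
def omega (b : ℕ) : ℂ := Complex.exp (2 * Real.pi * Complex.I / b)

/-- The `k`-th Walsh function in base `b`. Here `Nat.digits b k` lists the digits of `k` starting
with the lowest one, and `Real.digits x b i` is the digit of `x ∈ [0,1)` at `b ^ (-(i + 1))`, in
the expansion with infinitely many digits different from `b - 1`. -/
def wal (b : ℕ) [NeZero b] (k : ℕ) (x : ℝ) : ℂ :=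
  omega b ^ (∑ i ∈ Finset.range (Nat.digits b k).length,
    (Nat.digits b k).getD i 0 * (Real.digits x b i : ℕ))

/-- The multivariate Walsh function. -/
def walMulti (b : ℕ) [NeZero b] {s : ℕ} (k : Fin s → ℕ) (x : Fin s → ℝ) : ℂ :=
  ∏ j, wal b (k j) (x j)

/-- The Walsh coefficient of `f` at `k`. -/
def walshCoeff (b : ℕ) [NeZero b] {s : ℕ} (f : (Fin s → ℝ) → ℂ) (k : Fin s → ℕ) : ℂ :=
  ∫ x in Set.univ.pi (fun _ : Fin s => Set.Ico (0 : ℝ) 1), f x * conj (walMulti b k x)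

/-- `m_b = min_{1 ≤ c ≤ b - 1} |1 - ω_b^{-c}|`. -/
def mMin (b : ℕ) : ℝ := ⨅ c : Finset.Icc 1 (b - 1), ‖1 - conj (omega b) ^ (c : ℕ)‖

/-- `M_b = max_{1 ≤ c ≤ b - 1} |1 - ω_b^{-c}|`. -/
def mMax (b : ℕ) : ℝ := ⨆ c : Finset.Icc 1 (b - 1), ‖1 - conj (omega b) ^ (c : ℕ)‖

/-- The constant `(b m_b / (b - M_b)) (1 - (M_b / b) ^ n)`. -/
def constC (b n : ℕ) : ℝ :=
  b * mMin b / (b - mMax b) * (1 - (mMax b / b) ^ n)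

/-- The closed unit cube `[0,1]^s`. -/
def cube (s : ℕ) : Set (Fin s → ℝ) := Set.univ.pi (fun _ => Set.Icc (0 : ℝ) 1)

/-- The first partial derivative in `x_j` on the cube (one-sided on the faces). -/
def partialDeriv {s : ℕ} (j : Fin s) (g : (Fin s → ℝ) → ℝ) : (Fin s → ℝ) → ℝ :=
  fun x => derivWithin (fun t => g (Function.update x j t)) (Set.Icc 0 1) (x j)

/-- `f^{(n_1, …, n_s)} = (∂/∂x_1)^{n_1} ⋯ (∂/∂x_s)^{n_s} f`, where `∂/∂x_s` acts first. -/
def mixedPartial {s : ℕ} (n : Fin s → ℕ) (f : (Fin s → ℝ) → ℝ) : (Fin s → ℝ) → ℝ :=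
  (List.finRange s).foldr (fun j g => (partialDeriv j)^[n j] g) f

/-- `f` has continuous mixed partial derivatives up to order `α_j` in each variable `x_j` on the
cube: for every `n ≤ α` the derivative `f^{(n)}` exists and is continuous on the cube. Existence is
expressed step by step: whenever `n_i = 0` for `i < j` and `n_j < α_j`, the next derivative to be
taken, that of `f^{(n)}` with respect to `x_j`, exists at every point of the cube. -/
def HasContMixedPartials {s : ℕ} (α : Fin s → ℕ) (f : (Fin s → ℝ) → ℝ) : Prop :=
  ∀ n : Fin s → ℕ, n ≤ α →
    ContinuousOn (mixedPartial n f) (cube s) ∧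
    ∀ j : Fin s, (∀ i < j, n i = 0) → n j < α j → ∀ x ∈ cube s,
      DifferentiableWithinAt ℝ (fun t => mixedPartial n f (Function.update x j t))
        (Set.Icc 0 1) (x j)

/-- The `L^p` norm on the unit cube. -/
def cubeNorm {s : ℕ} (p : ℝ≥0∞) (g : (Fin s → ℝ) → ℝ) : ℝ :=
  (eLpNorm g p (volume.restrict (cube s))).toReal

end Walsh

end

/-!
Integrating by parts `n_j` times in the variable `x_j` replaces each factor `conj (wal_{k_j})`
of the Walsh function by its `n_j`-fold primitive, so everything rests on bounds for these
primitives.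

A Walsh function is a product of step characters `χ`, which satisfy `χ (x + L) = ζ χ x` with a
root of unity `ζ ≠ 1`. If `f` has this quasi-periodicity, so has its primitive minus the constant
`J = (∫_0^L f) / (1 - ζ)`. Hence the primitive of `f` is periodic and vanishes at the endpoints of
the unit interval, which removes all boundary terms; its mean is `J`; and it differs from
`J (1 - χ)` by a quasi-periodic function that is as small as `∫_0^y f` for `0 ≤ y ≤ L`. Iterating
the last fact yields the supremum bounds, each further primitive contributing one more term of the
geometric sum `∑ (M_b / b) ^ i`.

For `b = 2` the periodic parts of the iterated primitives are nonnegative. Their `L^1` norms are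
therefore their means, their suprema are at most twice these, and Hölder's inequality with respect
to the measure with density `|K|`, where `K` is the kernel, interpolates between the two bounds.
-/

namespace Walsh

/-! ### Quasi-periodic functions -/

/-- Functions that are multiplied by `ζ` under translation by `L`. -/
def QuasiPeriodic (ζ : ℂ) (L : ℝ) (f : ℝ → ℂ) : Prop := ∀ x, f (x + L) = ζ * f x

/-- The quasi-periodic function with the value `ζ ^ n` on the cell `[n L, (n + 1) L)`; a Walsh
function is a product of such functions. -/
noncomputable def stepChar (L : ℝ) (ζ : ℂ) (t : ℝ) : ℂ := ζ ^ ⌊t / L⌋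

namespace QuasiPeriodic

variable {ζ : ℂ} {L : ℝ} {f : ℝ → ℂ}

theorem apply_add_intCast_mul (hf : QuasiPeriodic ζ L f) (hζ : ζ ≠ 0) (n : ℤ) (x : ℝ) :
    f (x + n * L) = ζ ^ n * f x := by
  induction n using Int.induction_on with
  | zero => simp
  | succ n ih =>
    rw [zpow_add_one₀ hζ, mul_right_comm, ← ih, mul_comm _ ζ, ← hf]
    push_cast
    ring_nf
  | pred n ih =>
    rw [zpow_sub_one₀ hζ, mul_right_comm, ← ih, ← div_eq_mul_inv, eq_div_iff hζ, mul_comm _ ζ,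
      ← hf]
    push_cast
    ring_nf

theorem eq_stepChar_mul (hf : QuasiPeriodic ζ L f) (hζ : ζ ≠ 0) (hL : L ≠ 0) (x : ℝ) :
    f x = stepChar L ζ x * f (L * Int.fract (x / L)) := by
  rw [stepChar, ← hf.apply_add_intCast_mul hζ, mul_comm L, ← add_mul, Int.fract_add_floor,
    div_mul_cancel₀ x hL]

theorem periodic (hf : QuasiPeriodic ζ L f) (hζ : ζ ≠ 0) {n : ℕ} (hn : ζ ^ n = 1) :
    Function.Periodic f (n * L) := fun x => by
  simpa [hn] using hf.apply_add_intCast_mul hζ n x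

theorem mul_periodic (hf : QuasiPeriodic ζ L f) {u : ℝ → ℂ} (hu : Function.Periodic u L) :
    QuasiPeriodic ζ L fun x => f x * u x := fun x => by
  simp only [hf x, hu x, mul_assoc]

theorem primitive_sub_const (hf : QuasiPeriodic ζ L f) (hζ : ζ ≠ 1)
    (hint : ∀ u v, IntervalIntegrable f volume u v) :
    QuasiPeriodic ζ L fun x => (∫ t in 0..x, f t) - (∫ t in 0..L, f t) / (1 - ζ) := fun x => by
  have hshift : ∫ t in L..x + L, f t = ζ * ∫ t in 0..x, f t := by
    rw [← intervalIntegral.integral_const_mul, ← funext hf,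
      intervalIntegral.integral_comp_add_right, zero_add]
  have hsplit := intervalIntegral.integral_add_adjacent_intervals (hint 0 L) (hint L (x + L))
  have : 1 - ζ ≠ 0 := sub_ne_zero.2 hζ.symm
  simp only [← hsplit, hshift]
  field_simp
  ring

theorem primitive_eq (hf : QuasiPeriodic ζ L f) (h0 : ζ ≠ 0) (hζ : ζ ≠ 1) (hL : L ≠ 0)
    (hint : ∀ u v, IntervalIntegrable f volume u v) (x : ℝ) :
    ∫ t in 0..x, f t = (1 - stepChar L ζ x) * ((∫ t in 0..L, f t) / (1 - ζ)) +
      stepChar L ζ x * ∫ t in 0..L * Int.fract (x / L), f t := by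
  linear_combination (hf.primitive_sub_const hζ hint).eq_stepChar_mul h0 hL x

theorem periodic_primitive (hf : QuasiPeriodic ζ L f) (h0 : ζ ≠ 0) (hζ : ζ ≠ 1)
    (hint : ∀ u v, IntervalIntegrable f volume u v) {n : ℕ} (hn : ζ ^ n = 1) :
    Function.Periodic (fun x => ∫ t in 0..x, f t) (n * L) := fun x => by
  simpa using (hf.primitive_sub_const hζ hint).periodic h0 hn x

theorem integral_eq_zero (hf : QuasiPeriodic ζ L f) (h0 : ζ ≠ 0) (hζ : ζ ≠ 1)
    (hint : ∀ u v, IntervalIntegrable f volume u v) {n : ℕ} (hn : ζ ^ n = 1) :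
    ∫ t in 0..n * L, f t = 0 := by
  simpa using hf.periodic_primitive h0 hζ hint hn 0

theorem integral_primitive (hf : QuasiPeriodic ζ L f) (h0 : ζ ≠ 0) (hζ : ζ ≠ 1)
    (hint : ∀ u v, IntervalIntegrable f volume u v) {n : ℕ} (hn : ζ ^ n = 1) :
    ∫ x in 0..n * L, ∫ t in 0..x, f t = n * L * ((∫ t in 0..L, f t) / (1 - ζ)) := by
  have hcont := intervalIntegral.continuous_primitive hint 0
  have hzero := (hf.primitive_sub_const hζ hint).integral_eq_zero h0 hζ
    (fun u v => (hcont.sub continuous_const).intervalIntegrable u v) hn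
  rw [intervalIntegral.integral_sub (hcont.intervalIntegrable _ _) (by simp),
    intervalIntegral.integral_const, sub_zero, sub_eq_zero] at hzero
  simpa using hzero

end QuasiPeriodic

section StepChar

variable {L : ℝ} {ζ : ℂ}

theorem quasiPeriodic_stepChar (hL : L ≠ 0) (hζ : ζ ≠ 0) : QuasiPeriodic ζ L (stepChar L ζ) := by
  intro x
  rw [stepChar, stepChar, add_div, div_self hL, Int.floor_add_one, zpow_add_one₀ hζ, mul_comm]

theorem norm_stepChar (hζ : ‖ζ‖ = 1) (x : ℝ) : ‖stepChar L ζ x‖ = 1 := by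
  rw [stepChar, norm_zpow, hζ, one_zpow]

theorem stepChar_eq_one {x : ℝ} (hL : 0 < L) (hx : x ∈ Set.Ico 0 L) : stepChar L ζ x = 1 := by
  have : ⌊x / L⌋ = 0 := Int.floor_eq_zero_iff.2 ⟨div_nonneg hx.1 hL.le, (div_lt_one hL).2 hx.2⟩
  rw [stepChar, this, zpow_zero]

theorem measurable_stepChar (L : ℝ) (ζ : ℂ) : Measurable (stepChar L ζ) :=
  (measurable_from_top (f := fun n : ℤ => ζ ^ n)).comp
    (Int.measurable_floor.comp (measurable_id.div_const L))

theorem stepChar_continuousWithinAt_Ioi (hL : 0 < L) (ζ : ℂ) (x : ℝ) :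
    ContinuousWithinAt (stepChar L ζ) (Set.Ioi x) x := by
  have hdiv : Filter.Tendsto (· / L) (nhdsWithin x (Set.Ioi x)) (nhdsWithin (x / L) (Set.Ici _)) :=
    ((continuous_id.div_const L).continuousWithinAt.tendsto_nhdsWithin fun t ht =>
      div_le_div_of_nonneg_right (le_of_lt ht) hL.le)
  exact ((Filter.tendsto_pure_pure (fun n : ℤ => ζ ^ n) _).comp
    ((tendsto_floor_right_pure_floor _).comp hdiv)).mono_right (pure_le_nhds _)

theorem intervalIntegrable_stepChar_mul (hζ : ‖ζ‖ = 1) {u : ℝ → ℂ} (hu : Continuous u)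
    (v w : ℝ) : IntervalIntegrable (fun t => stepChar L ζ t * u t) volume v w := by
  refine (hu.intervalIntegrable v w).mono_fun
    ((measurable_stepChar L ζ).mul hu.measurable).aestronglyMeasurable (.of_forall fun t => ?_)
  simp only [norm_mul, norm_stepChar hζ, one_mul, le_refl]

theorem integral_stepChar_mul_of_le (hL : 0 < L) (u : ℝ → ℂ) {y : ℝ} (h0 : 0 ≤ y) (hy : y ≤ L) :
    ∫ t in 0..y, stepChar L ζ t * u t = ∫ t in 0..y, u t :=
  intervalIntegral.integral_congr_Ioo_of_le h0 fun t ht => by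
    rw [stepChar_eq_one hL ⟨ht.1.le, ht.2.trans_le hy⟩, one_mul]

end StepChar

theorem norm_integral_one_sub_le {f : ℝ → ℂ} {T : ℝ} (hf : ∀ t, ‖f t‖ ≤ 1)
    (hint : ∀ u v, IntervalIntegrable f volume u v) (hT : ∫ t in 0..T, f t = 0)
    {x : ℝ} (hx : x ∈ Set.Icc 0 T) : ‖∫ t in 0..x, (1 - f t)‖ ≤ T := by
  have hsplit := intervalIntegral.integral_add_adjacent_intervals (hint 0 x) (hint x T)
  have htail : ‖∫ t in x..T, f t‖ ≤ 1 * |T - x| :=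
    intervalIntegral.norm_integral_le_of_norm_le_const fun t _ => hf t
  rw [abs_of_nonneg (sub_nonneg.2 hx.2)] at htail
  rw [intervalIntegral.integral_sub (by simp) (hint 0 x), intervalIntegral.integral_const,
    eq_neg_of_add_eq_zero_left (hsplit.trans hT), sub_neg_eq_add]
  calc _ ≤ ‖(x - 0) • (1 : ℂ)‖ + ‖∫ t in x..T, f t‖ := norm_add_le _ _
    _ ≤ x + (T - x) := by
        gcongr
        · simp [abs_of_nonneg hx.1]
        · simpa using htail
    _ = T := by ring

theorem mul_fract_div_mem_Icc {L : ℝ} (hL : 0 ≤ L) (x : ℝ) :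
    L * Int.fract (x / L) ∈ Set.Icc 0 L :=
  ⟨mul_nonneg hL (Int.fract_nonneg _), mul_le_of_le_one_right hL (Int.fract_lt_one _).le⟩

namespace QuasiPeriodic

variable {ζ : ℂ} {L M K : ℝ} {f : ℝ → ℂ}

/- With `y = x mod L` and `χ = stepChar L ζ x`, the primitive at `x` is
`((1 - χ) ∫_y^L f + (1 - χ ζ) ∫_0^y f) / (1 - ζ)`. -/
theorem norm_integral_le (hf : QuasiPeriodic ζ L f) (hζ : ‖ζ‖ = 1) (hζ1 : ζ ≠ 1) (hL : 0 < L)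
    (hint : ∀ u v, IntervalIntegrable f volume u v) (hM : ∀ n : ℤ, ‖1 - ζ ^ n‖ ≤ M)
    (hK : ∀ t, ‖f t‖ ≤ K) (x : ℝ) : ‖∫ t in 0..x, f t‖ ≤ M * (K * L) / ‖1 - ζ‖ := by
  have hζ0 : ζ ≠ 0 := norm_ne_zero_iff.1 (hζ ▸ one_ne_zero)
  have hsub : 1 - ζ ≠ 0 := sub_ne_zero.2 hζ1.symm
  set y := L * Int.fract (x / L) with hy
  obtain ⟨hy0, hyL⟩ : y ∈ Set.Icc 0 L := mul_fract_div_mem_Icc hL.le x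
  have hsplit := intervalIntegral.integral_add_adjacent_intervals (hint 0 y) (hint y L)
  have hprim : ∫ t in 0..x, f t = ((1 - ζ ^ ⌊x / L⌋) * (∫ t in y..L, f t) +
      (1 - ζ ^ (⌊x / L⌋ + 1)) * ∫ t in 0..y, f t) / (1 - ζ) := by
    rw [hf.primitive_eq hζ0 hζ1 hL.ne' hint, ← hy, ← hsplit, stepChar, zpow_add_one₀ hζ0]
    field_simp
    ring
  have hle : ∀ u v, u ≤ v → ‖∫ t in u..v, f t‖ ≤ K * (v - u) := fun u v huv => by
    simpa [abs_of_nonneg (sub_nonneg.2 huv)] using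
      intervalIntegral.norm_integral_le_of_norm_le_const (a := u) (b := v) fun t _ => hK t
  have hM0 : 0 ≤ M := (norm_nonneg _).trans (hM 0)
  rw [hprim, norm_div]
  gcongr
  calc _ ≤ M * (K * (L - y)) + M * (K * (y - 0)) := by
        refine (norm_add_le _ _).trans ?_
        rw [norm_mul, norm_mul]
        gcongr
        exacts [hM _, hle y L hyL, hM _, hle 0 y hy0]
    _ = M * (K * L) := by ring

theorem norm_primitive_sub_le (hf : QuasiPeriodic ζ L f) (hζ : ‖ζ‖ = 1) (hζ1 : ζ ≠ 1)
    (hL : 0 < L) (hint : ∀ u v, IntervalIntegrable f volume u v)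
    (hK : ∀ y ∈ Set.Icc 0 L, ‖∫ t in 0..y, f t‖ ≤ K) (x : ℝ) :
    ‖(∫ t in 0..x, f t) - (∫ t in 0..L, f t) / (1 - ζ) * (1 - stepChar L ζ x)‖ ≤ K := by
  have hζ0 : ζ ≠ 0 := norm_ne_zero_iff.1 (hζ ▸ one_ne_zero)
  rw [hf.primitive_eq hζ0 hζ1 hL.ne' hint, mul_comm (_ / _), add_sub_cancel_left, norm_mul,
    norm_stepChar hζ, one_mul]
  exact hK _ (mul_fract_div_mem_Icc hL.le x)

theorem norm_primitive_le (hf : QuasiPeriodic ζ L f) (hζ : ‖ζ‖ = 1) (hζ1 : ζ ≠ 1)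
    (hL : 0 < L) (hint : ∀ u v, IntervalIntegrable f volume u v) (hM : ∀ n : ℤ, ‖1 - ζ ^ n‖ ≤ M)
    (hK : ∀ y ∈ Set.Icc 0 L, ‖∫ t in 0..y, f t‖ ≤ K) (x : ℝ) :
    ‖∫ t in 0..x, f t‖ ≤ ‖(∫ t in 0..L, f t) / (1 - ζ)‖ * M + K := by
  rw [← add_sub_cancel ((∫ t in 0..L, f t) / (1 - ζ) * (1 - stepChar L ζ x)) (∫ t in 0..x, f t)]
  refine (norm_add_le _ _).trans
    (add_le_add ?_ (hf.norm_primitive_sub_le hζ hζ1 hL hint hK x))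
  rw [norm_mul]
  exact mul_le_mul_of_nonneg_left (hM _) (norm_nonneg _)

/- The primitive of `f` is `J (1 - χ) + g`, where `χ` is the step character, `J` the mean of the
primitive, and `g` is bounded by `K` and again quasi-periodic. -/
theorem norm_integral_primitive_le (hf : QuasiPeriodic ζ L f) (hζ : ‖ζ‖ = 1) (hζ1 : ζ ≠ 1)
    (hL : 0 < L) (hint : ∀ u v, IntervalIntegrable f volume u v) (hM : ∀ n : ℤ, ‖1 - ζ ^ n‖ ≤ M)
    (hK : ∀ y ∈ Set.Icc 0 L, ‖∫ t in 0..y, f t‖ ≤ K) {n : ℕ} (hn : ζ ^ n = 1)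
    {x : ℝ} (hx : x ∈ Set.Icc 0 (n * L)) :
    ‖∫ s in 0..x, ∫ t in 0..s, f t‖ ≤
      ‖(∫ t in 0..L, f t) / (1 - ζ)‖ * (n * L) + M * (K * L) / ‖1 - ζ‖ := by
  have hζ0 : ζ ≠ 0 := norm_ne_zero_iff.1 (hζ ▸ one_ne_zero)
  set J := (∫ t in 0..L, f t) / (1 - ζ)
  set χ := stepChar L ζ
  have hχint : ∀ u v, IntervalIntegrable χ volume u v := by
    simpa using intervalIntegrable_stepChar_mul (L := L) hζ (continuous_const (y := 1))
  have hχquasi : QuasiPeriodic ζ L χ := quasiPeriodic_stepChar hL.ne' hζ0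
  have hJint : ∀ u v, IntervalIntegrable (fun s => J * (1 - χ s)) volume u v := fun u v =>
    (intervalIntegrable_const.sub (hχint u v)).const_mul J
  set g : ℝ → ℂ := fun s => (∫ t in 0..s, f t) - J * (1 - χ s) with hg
  have hgint : ∀ u v, IntervalIntegrable g volume u v := fun u v =>
    ((intervalIntegral.continuous_primitive hint 0).intervalIntegrable u v).sub (hJint u v)
  have hgquasi : QuasiPeriodic ζ L g := fun s => by
    linear_combination hf.primitive_sub_const hζ1 hint s + J * hχquasi s
  have hsum : ∫ s in 0..x, ∫ t in 0..s, f t =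
      J * (∫ s in 0..x, (1 - χ s)) + ∫ s in 0..x, g s := by
    rw [← intervalIntegral.integral_const_mul,
      ← intervalIntegral.integral_add (hJint 0 x) (hgint 0 x)]
    simp only [hg, add_sub_cancel]
  have hone : ‖∫ s in 0..x, (1 - χ s)‖ ≤ n * L :=
    norm_integral_one_sub_le (fun t => (norm_stepChar hζ t).le) hχint
      (hχquasi.integral_eq_zero hζ0 hζ1 hχint hn) hx
  rw [hsum]
  refine (norm_add_le _ _).trans (add_le_add ?_ (hgquasi.norm_integral_le hζ hζ1 hL hgint hM
    (hf.norm_primitive_sub_le hζ hζ1 hL hint hK) x))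
  rw [norm_mul]
  exact mul_le_mul_of_nonneg_left hone (norm_nonneg _)

end QuasiPeriodic

/-! ### Iterated primitives of step characters -/

/-- The iterated primitive `x ↦ ∫_0^x χ_{a₁} (∫_0^{t₁} χ_{a₂} (⋯))` along the list `a₁, a₂, …`,
where `χ_a` is the step character with the value `z a ^ n` on the `n`-th cell of length `b ^ (-a)`.
Along an increasing list this is the periodic factor of an iterated primitive of
`χ_{a₁} χ_{a₂} ⋯`. -/
noncomputable def iterInt (b : ℕ) (z : ℕ → ℂ) : List ℕ → ℝ → ℂ
  | [] => fun _ => 1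
  | a :: l => fun x => ∫ t in 0..x, stepChar ((b : ℝ) ^ a)⁻¹ (z a) t * iterInt b z l t

/-- The mean of `iterInt b z l` over a period. -/
noncomputable def iterMean (b : ℕ) (z : ℕ → ℂ) (l : List ℕ) : ℂ :=
  (l.map fun a => ((b : ℂ) ^ a)⁻¹ / (1 - z a)).prod

/-- The bound on `iterMean b z l` when `m ≤ ‖1 - z a‖` for all `a ∈ l`. -/
noncomputable def meanBound (b : ℕ) (m : ℝ) (l : List ℕ) : ℝ :=
  ((b : ℝ) ^ l.sum * m ^ l.length)⁻¹

section IterInt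

variable {b : ℕ} {z : ℕ → ℂ} {l : List ℕ} {a : ℕ}

theorem iterMean_cons : iterMean b z (a :: l) = ((b : ℂ) ^ a)⁻¹ * iterMean b z l / (1 - z a) := by
  rw [iterMean, List.map_cons, List.prod_cons, iterMean]
  ring

theorem meanBound_cons {m : ℝ} :
    meanBound b m (a :: l) = ((b : ℝ) ^ a)⁻¹ * meanBound b m l / m := by
  simp only [meanBound, List.sum_cons, List.length_cons, pow_add, pow_one, mul_inv]
  ring

theorem meanBound_nonneg {m : ℝ} (hm : 0 ≤ m) : 0 ≤ meanBound b m l := by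
  unfold meanBound
  positivity

theorem norm_iterMean_le {m : ℝ} (hm : 0 < m) (hz : ∀ c ∈ l, m ≤ ‖1 - z c‖) :
    ‖iterMean b z l‖ ≤ meanBound b m l := by
  induction l with
  | nil => simp [iterMean, meanBound]
  | cons a l ih =>
    rw [List.forall_mem_cons] at hz
    rw [iterMean_cons, meanBound_cons, norm_div, norm_mul]
    have := meanBound_nonneg (b := b) (l := l) hm.le
    gcongr
    exacts [by simp, ih hz.2, hz.1]

theorem ne_one_of_le_norm_one_sub {m : ℝ} (hm : 0 < m) {ζ : ℂ} (h : m ≤ ‖1 - ζ‖) : ζ ≠ 1 := by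
  rintro rfl
  simp [hm.not_ge] at h

theorem pow_pow_sub_eq_one {ζ : ℂ} (hζ : ζ ^ b = 1) {a' : ℕ} (h : a' < a) :
    ζ ^ b ^ (a - a') = 1 := by
  obtain ⟨d, hd⟩ : b ∣ b ^ (a - a') := dvd_pow_self b (Nat.sub_ne_zero_of_lt h)
  rw [hd, pow_mul, hζ, one_pow]

variable [NeZero b]

theorem inv_pow_pos (b : ℕ) [NeZero b] (a : ℕ) : 0 < ((b : ℝ) ^ a)⁻¹ := by
  have := NeZero.pos b
  positivity

theorem inv_pow_le_inv_pow_div {a' : ℕ} (h : a' < a) : ((b : ℝ) ^ a)⁻¹ ≤ ((b : ℝ) ^ a')⁻¹ / b := by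
  have hb : (1 : ℝ) ≤ b := by exact_mod_cast NeZero.pos b
  rw [div_eq_mul_inv, ← mul_inv, ← pow_succ]
  gcongr
  exact h

theorem inv_pow_eq_mul_inv_pow {a' : ℕ} (h : a' ≤ a) :
    ((b : ℝ) ^ a')⁻¹ = (b ^ (a - a') : ℕ) * ((b : ℝ) ^ a)⁻¹ := by
  have : (b : ℝ) ≠ 0 := NeZero.ne _
  rw [Nat.cast_pow, pow_sub₀ _ this h, mul_right_comm, mul_inv_cancel₀ (pow_ne_zero _ this),
    one_mul]

variable (hroot : ∀ a, z a ^ b = 1)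
include hroot

theorem norm_root (a : ℕ) : ‖z a‖ = 1 := Complex.norm_eq_one_of_pow_eq_one (hroot a) (NeZero.ne b)

theorem root_ne_zero (a : ℕ) : z a ≠ 0 := norm_ne_zero_iff.1 (norm_root hroot a ▸ one_ne_zero)

theorem continuous_iterInt (l : List ℕ) : Continuous (iterInt b z l) := by
  induction l with
  | nil => exact continuous_const
  | cons a l ih =>
    exact intervalIntegral.continuous_primitive
      (intervalIntegrable_stepChar_mul (norm_root hroot a) ih) 0

theorem intervalIntegrable_stepChar_mul_iterInt (a : ℕ) (l : List ℕ) (u v : ℝ) :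
    IntervalIntegrable (fun t => stepChar ((b : ℝ) ^ a)⁻¹ (z a) t * iterInt b z l t) volume u v :=
  intervalIntegrable_stepChar_mul (norm_root hroot a) (continuous_iterInt hroot l) u v

theorem iterInt_periodic (hne : ∀ c ∈ l, z c ≠ 1) (hl : (a :: l).Pairwise (· < ·)) :
    Function.Periodic (iterInt b z l) ((b : ℝ) ^ a)⁻¹ := by
  induction l generalizing a with
  | nil => exact fun _ => rfl
  | cons c l ih =>
    rw [List.forall_mem_cons] at hne
    obtain ⟨hac, hcl⟩ := List.pairwise_cons.1 hl
    have hlt := hac c List.mem_cons_self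
    rw [inv_pow_eq_mul_inv_pow hlt.le]
    exact ((quasiPeriodic_stepChar (inv_pow_pos b c).ne' (root_ne_zero hroot c)).mul_periodic
      (ih hne.2 hcl)).periodic_primitive (root_ne_zero hroot c) hne.1
      (intervalIntegrable_stepChar_mul_iterInt hroot c l) (pow_pow_sub_eq_one (hroot c) hlt)

theorem quasiPeriodic_stepChar_mul_iterInt (hne : ∀ c ∈ l, z c ≠ 1)
    (hl : (a :: l).Pairwise (· < ·)) : QuasiPeriodic (z a) ((b : ℝ) ^ a)⁻¹ fun t =>
      stepChar ((b : ℝ) ^ a)⁻¹ (z a) t * iterInt b z l t :=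
  (quasiPeriodic_stepChar (inv_pow_pos b a).ne' (root_ne_zero hroot a)).mul_periodic
    (iterInt_periodic hroot hne hl)

theorem iterInt_cons_mul_inv_pow (hne : ∀ c ∈ a :: l, z c ≠ 1) (hl : (a :: l).Pairwise (· < ·))
    {a' : ℕ} (ha : a' < a) (n : ℕ) : iterInt b z (a :: l) (n * ((b : ℝ) ^ a')⁻¹) = 0 := by
  rw [List.forall_mem_cons] at hne
  rw [inv_pow_eq_mul_inv_pow ha.le, ← mul_assoc, ← Nat.cast_mul]
  refine (quasiPeriodic_stepChar_mul_iterInt hroot hne.2 hl).integral_eq_zero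
    (root_ne_zero hroot a) hne.1 (intervalIntegrable_stepChar_mul_iterInt hroot a l) ?_
  rw [mul_comm n, pow_mul, pow_pow_sub_eq_one (hroot a) ha, one_pow]

theorem integral_iterInt (hne : ∀ c ∈ l, z c ≠ 1) (hl : (a :: l).Pairwise (· < ·)) :
    ∫ t in 0..((b : ℝ) ^ a)⁻¹, iterInt b z l t = ((b : ℂ) ^ a)⁻¹ * iterMean b z l := by
  induction l generalizing a with
  | nil => simp [iterInt, iterMean]
  | cons c l ih =>
    rw [List.forall_mem_cons] at hne
    obtain ⟨hac, hcl⟩ := List.pairwise_cons.1 hl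
    have hlt := hac c List.mem_cons_self
    have hscale := inv_pow_eq_mul_inv_pow (b := b) hlt.le
    have hprim := (quasiPeriodic_stepChar_mul_iterInt hroot hne.2 hcl).integral_primitive
      (root_ne_zero hroot c) hne.1 (intervalIntegrable_stepChar_mul_iterInt hroot c l)
      (pow_pow_sub_eq_one (hroot c) hlt)
    rw [integral_stepChar_mul_of_le (inv_pow_pos b c) _ (inv_pow_pos b c).le le_rfl, ih hne.2 hcl,
      ← hscale, ← iterMean_cons, ← Complex.ofReal_natCast, ← Complex.ofReal_mul, ← hscale] at hprim
    simpa [iterInt] using hprim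

theorem integral_div_one_sub_eq_iterMean (hne : ∀ c ∈ l, z c ≠ 1) (hl : (a :: l).Pairwise (· < ·)) :
    (∫ t in 0..((b : ℝ) ^ a)⁻¹, stepChar ((b : ℝ) ^ a)⁻¹ (z a) t * iterInt b z l t) / (1 - z a) =
      iterMean b z (a :: l) := by
  rw [integral_stepChar_mul_of_le (inv_pow_pos b a) _ (inv_pow_pos b a).le le_rfl,
    integral_iterInt hroot hne hl, iterMean_cons]

section Bounds

variable {m M : ℝ} (hm : 0 < m) (hM : ∀ a (n : ℤ), ‖1 - z a ^ n‖ ≤ M)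
include hm hM

theorem norm_integral_iterInt_le (hz : ∀ c ∈ l, m ≤ ‖1 - z c‖) (hl : (a :: l).Pairwise (· < ·))
    {x : ℝ} (hx : x ∈ Set.Icc 0 ((b : ℝ) ^ a)⁻¹) :
    ‖∫ t in 0..x, iterInt b z l t‖ ≤ ((b : ℝ) ^ a)⁻¹ *
      (meanBound b m l * ∑ i ∈ Finset.range (l.length + 1), (M / b) ^ i) := by
  induction l generalizing a x with
  | nil => simpa [iterInt, meanBound, abs_of_nonneg hx.1] using hx.2
  | cons c l ih =>
    obtain ⟨hac, hcl⟩ := List.pairwise_cons.1 hl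
    rw [List.forall_mem_cons] at hz
    have hlt := hac c List.mem_cons_self
    have hscale := inv_pow_eq_mul_inv_pow (b := b) hlt.le
    have hne : ∀ d ∈ l, z d ≠ 1 := fun d hd => ne_one_of_le_norm_one_sub hm (hz.2 d hd)
    have hprim := (quasiPeriodic_stepChar_mul_iterInt hroot hne hcl).norm_integral_primitive_le
      (norm_root hroot c) (ne_one_of_le_norm_one_sub hm hz.1) (inv_pow_pos b c)
      (intervalIntegrable_stepChar_mul_iterInt hroot c l) (hM c)
      (fun y hy => (integral_stepChar_mul_of_le (inv_pow_pos b c) _ hy.1 hy.2).symm ▸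
        ih hz.2 hcl hy)
      (pow_pow_sub_eq_one (hroot c) hlt) (hscale ▸ hx)
    rw [integral_div_one_sub_eq_iterMean hroot hne hcl, ← hscale] at hprim
    have hQ := meanBound_nonneg (b := b) (l := l) hm.le
    have hM0 : 0 ≤ M := (norm_nonneg _).trans (hM c 0)
    set S := ∑ i ∈ Finset.range (l.length + 1), (M / b) ^ i with hS
    have : 0 ≤ S := Finset.sum_nonneg fun i _ => by positivity
    calc _ ≤ _ := hprim
      _ ≤ meanBound b m (c :: l) * ((b : ℝ) ^ a)⁻¹ +
          M * (((b : ℝ) ^ c)⁻¹ * (meanBound b m l * S) * (((b : ℝ) ^ a)⁻¹ / b)) / m := by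
        gcongr
        exacts [norm_iterMean_le hm (List.forall_mem_cons.2 hz), inv_pow_le_inv_pow_div hlt, hz.1]
      _ = ((b : ℝ) ^ a)⁻¹ * (meanBound b m (c :: l) * (M / b * S + 1)) := by
        rw [meanBound_cons]
        ring
      _ = _ := by rw [hS, List.length_cons, geom_sum_succ (n := l.length + 1)]

theorem norm_iterInt_cons_le (hz : ∀ c ∈ a :: l, m ≤ ‖1 - z c‖) (hl : (a :: l).Pairwise (· < ·))
    (x : ℝ) : ‖iterInt b z (a :: l) x‖ ≤ meanBound b m (a :: l) *
      (M + m * ∑ i ∈ Finset.range (l.length + 1), (M / b) ^ i) := by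
  obtain ⟨hza, hzl⟩ := List.forall_mem_cons.1 hz
  have hne : ∀ c ∈ l, z c ≠ 1 := fun c hc => ne_one_of_le_norm_one_sub hm (hzl c hc)
  have hprim := (quasiPeriodic_stepChar_mul_iterInt hroot hne hl).norm_primitive_le
    (norm_root hroot a) (ne_one_of_le_norm_one_sub hm hza) (inv_pow_pos b a)
    (intervalIntegrable_stepChar_mul_iterInt hroot a l) (hM a)
    (fun y hy => (integral_stepChar_mul_of_le (inv_pow_pos b a) _ hy.1 hy.2).symm ▸
      norm_integral_iterInt_le hroot hm hM hzl hl hy) x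
  rw [integral_div_one_sub_eq_iterMean hroot hne hl] at hprim
  have hM0 : 0 ≤ M := (norm_nonneg _).trans (hM a 0)
  calc _ ≤ _ := hprim
    _ ≤ meanBound b m (a :: l) * M + _ :=
      add_le_add (mul_le_mul_of_nonneg_right (norm_iterMean_le hm hz) hM0) le_rfl
    _ = _ := by
      rw [meanBound_cons]
      field_simp

end Bounds

end IterInt

/-! ### Positivity for `b = 2` -/

section Two

open scoped ComplexOrder

theorem integral_nonneg_of_forall_nonneg {u : ℝ → ℂ} (hu : ∀ t, 0 ≤ u t) {v w : ℝ} (h : v ≤ w) :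
    0 ≤ ∫ t in v..w, u t := by
  rw [intervalIntegral.integral_of_le h]
  exact integral_nonneg hu

/- On the cells where the step character is `1` the primitive is `∫_0^y u` with `y = x mod L`, on
the other ones it is `∫_y^L u`. -/
theorem integral_stepChar_neg_one_mul_mem_Icc {L : ℝ} (hL : 0 < L) {u : ℝ → ℂ} (hu : Continuous u)
    (hper : Function.Periodic u L) (hnonneg : ∀ t, 0 ≤ u t) (x : ℝ) :
    ∫ t in 0..x, stepChar L (-1) t * u t ∈ Set.Icc 0 (∫ t in 0..L, u t) := by
  obtain ⟨hy0, hyL⟩ := mul_fract_div_mem_Icc hL.le x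
  have hfirst := integral_nonneg_of_forall_nonneg hnonneg hy0
  have hlast := integral_nonneg_of_forall_nonneg hnonneg hyL
  have hsplit := intervalIntegral.integral_add_adjacent_intervals
    (hu.intervalIntegrable (μ := volume) 0 (L * Int.fract (x / L))) (hu.intervalIntegrable _ L)
  rw [((quasiPeriodic_stepChar hL.ne' (by simp)).mul_periodic hper).primitive_eq (by simp)
      (by norm_num) hL.ne' (intervalIntegrable_stepChar_mul (by simp) hu),
    integral_stepChar_mul_of_le hL u hL.le le_rfl, integral_stepChar_mul_of_le hL u hy0 hyL,
    ← hsplit, stepChar]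
  obtain h | h := Int.even_or_odd ⌊x / L⌋
  · rw [h.neg_one_zpow, sub_self, zero_mul, zero_add, one_mul]
    exact ⟨hfirst, le_add_of_nonneg_right hlast⟩
  · rw [h.neg_one_zpow]
    ring_nf
    exact ⟨hlast, le_add_of_nonneg_left hfirst⟩

variable {z : ℕ → ℂ} {l : List ℕ} {a : ℕ}

theorem iterMean_two (hz : ∀ c ∈ l, z c = -1) : iterMean 2 z l = meanBound 2 2 l := by
  induction l with
  | nil => simp [iterMean, meanBound]
  | cons a l ih =>
    rw [List.forall_mem_cons] at hz
    rw [iterMean_cons, ih hz.2, hz.1, meanBound_cons]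
    push_cast
    norm_num

variable (hroot : ∀ a, z a ^ 2 = 1)
include hroot

theorem iterInt_cons_two_mem_Icc (hz : ∀ c ∈ a :: l, z c = -1) (hl : (a :: l).Pairwise (· < ·))
    (hnonneg : ∀ x, 0 ≤ iterInt 2 z l x) (x : ℝ) :
    iterInt 2 z (a :: l) x ∈ Set.Icc 0 (∫ t in 0..((2 : ℝ) ^ a)⁻¹, iterInt 2 z l t) := by
  rw [List.forall_mem_cons] at hz
  have hne : ∀ c ∈ l, z c ≠ 1 := fun c hc => by rw [hz.2 c hc]; norm_num
  simp only [iterInt, hz.1]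
  exact integral_stepChar_neg_one_mul_mem_Icc (inv_pow_pos 2 a) (continuous_iterInt hroot l)
    (iterInt_periodic hroot hne hl) hnonneg x

theorem iterInt_two_nonneg (hz : ∀ c ∈ l, z c = -1) (hl : l.Pairwise (· < ·)) (x : ℝ) :
    0 ≤ iterInt 2 z l x := by
  induction l generalizing x with
  | nil => exact zero_le_one
  | cons a l ih =>
    exact (iterInt_cons_two_mem_Icc hroot hz hl
      (ih (List.forall_mem_cons.1 hz).2 (List.pairwise_cons.1 hl).2) x).1

theorem integral_norm_iterInt_two (hz : ∀ c ∈ l, z c = -1) (hl : (a :: l).Pairwise (· < ·)) :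
    ∫ t in 0..((2 : ℝ) ^ a)⁻¹, ‖iterInt 2 z l t‖ = ((2 : ℝ) ^ a)⁻¹ * meanBound 2 2 l := by
  have hne : ∀ c ∈ l, z c ≠ 1 := fun c hc => by rw [hz c hc]; norm_num
  have hmean := integral_iterInt hroot hne hl
  have hnorm : ∀ t, iterInt 2 z l t = (‖iterInt 2 z l t‖ : ℝ) := fun t =>
    Complex.eq_coe_norm_of_nonneg (iterInt_two_nonneg hroot hz (List.pairwise_cons.1 hl).2 t)
  rw [iterMean_two hz, funext hnorm, intervalIntegral.integral_ofReal] at hmean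
  refine Complex.ofReal_injective ?_
  push_cast at hmean ⊢
  exact hmean

theorem norm_iterInt_cons_two_le (hz : ∀ c ∈ a :: l, z c = -1) (hl : (a :: l).Pairwise (· < ·))
    (x : ℝ) : ‖iterInt 2 z (a :: l) x‖ ≤ 2 * meanBound 2 2 (a :: l) := by
  have hz' := (List.forall_mem_cons.1 hz).2
  obtain ⟨h0, hle⟩ := iterInt_cons_two_mem_Icc hroot hz hl
    (iterInt_two_nonneg hroot hz' (List.pairwise_cons.1 hl).2) x
  calc _ ≤ ‖∫ t in 0..((2 : ℝ) ^ a)⁻¹, iterInt 2 z l t‖ :=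
        CStarAlgebra.norm_le_norm_of_nonneg_of_le h0 hle
    _ ≤ ∫ t in 0..((2 : ℝ) ^ a)⁻¹, ‖iterInt 2 z l t‖ :=
        intervalIntegral.norm_integral_le_integral_norm (inv_pow_pos 2 a).le
    _ = 2 * meanBound 2 2 (a :: l) := by
        rw [integral_norm_iterInt_two hroot hz' hl, meanBound_cons]
        push_cast
        ring

end Two

/-! ### Products of step characters -/

/-- The product of the step characters at the positions in `l`, for digits encoded in `z`. -/
noncomputable def charProd (b : ℕ) (z : ℕ → ℂ) (l : List ℕ) (t : ℝ) : ℂ :=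
  (l.map fun a => stepChar ((b : ℝ) ^ a)⁻¹ (z a) t).prod

/-- The iterated primitive of `charProd b z (l.reverse ++ l')`, for decreasing
`l.reverse ++ l'`, taken once for every position in `l`. -/
noncomputable def charKernel (b : ℕ) (z : ℕ → ℂ) (l' l : List ℕ) (t : ℝ) : ℂ :=
  charProd b z l' t * iterInt b z l t

section CharKernel

theorem integral_mul_of_factorsThrough_floor {c f : ℝ → ℂ} {P : ℝ} (hP : 0 < P)
    (hc : c.FactorsThrough fun t => ⌊t / P⌋) (n : ℕ) {y : ℝ} (h0 : n * P ≤ y)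
    (h1 : y ≤ (n + 1) * P) : ∫ t in n * P..y, c t * f t = c (n * P) * ∫ t in n * P..y, f t := by
  rw [← intervalIntegral.integral_const_mul]
  refine intervalIntegral.integral_congr_Ioo_of_le h0 fun t ht => ?_
  congr 1
  refine hc ?_
  simp only
  rw [mul_div_cancel_right₀ _ hP.ne', Int.floor_natCast, Int.floor_eq_iff, le_div_iff₀ hP,
    div_lt_iff₀ hP]
  exact ⟨ht.1.le, ht.2.trans_le h1⟩

/- The primitive of `f` vanishes at the points where `c` jumps. -/
theorem integral_mul_eq_mul_integral {c f : ℝ → ℂ} {P : ℝ} (hP : 0 < P)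
    (hc : c.FactorsThrough fun t => ⌊t / P⌋)
    (hint : ∀ u v, IntervalIntegrable f volume u v)
    (hcint : ∀ u v, IntervalIntegrable (fun t => c t * f t) volume u v)
    (hf : ∀ n : ℕ, ∫ t in 0..n * P, f t = 0) {x : ℝ} (hx : 0 ≤ x) :
    ∫ t in 0..x, c t * f t = c x * ∫ t in 0..x, f t := by
  have hcell : ∀ (n : ℕ) (y : ℝ), n * P ≤ y → y ≤ (n + 1) * P →
      ∫ t in n * P..y, c t * f t = c (n * P) * ∫ t in 0..y, f t := fun n y h0 h1 => by
    rw [integral_mul_of_factorsThrough_floor hP hc n h0 h1,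
      ← intervalIntegral.integral_add_adjacent_intervals (hint 0 (n * P)) (hint _ y), hf, zero_add]
  have hjump : ∀ n : ℕ, ∫ t in 0..n * P, c t * f t = 0 := fun n => by
    induction n with
    | zero => simp
    | succ n ih =>
      have h := hcell n ((n + 1 : ℕ) * P) (by gcongr; simp) (by push_cast; rfl)
      rw [hf, mul_zero] at h
      rw [← intervalIntegral.integral_add_adjacent_intervals (hcint 0 (n * P)) (hcint _ _), ih, h,
        add_zero]
  have hdiv : 0 ≤ x / P := div_nonneg hx hP.le
  set n := ⌊x / P⌋₊ with hn
  have hxn : c (n * P) = c x := hc (by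
    simp only
    rw [mul_div_cancel_right₀ _ hP.ne', Int.floor_natCast, hn, Int.natCast_floor_eq_floor hdiv])
  rw [← intervalIntegral.integral_add_adjacent_intervals (hcint 0 (n * P)) (hcint _ x), hjump,
    zero_add, hcell n x ((le_div_iff₀ hP).1 (Nat.floor_le hdiv))
      ((div_le_iff₀ hP).1 (Nat.lt_floor_add_one _).le), hxn]

variable {b : ℕ} {z : ℕ → ℂ} {l l' : List ℕ} {a : ℕ}

theorem charProd_cons (b : ℕ) (z : ℕ → ℂ) (a : ℕ) (l : List ℕ) :
    charProd b z (a :: l) = fun t => stepChar ((b : ℝ) ^ a)⁻¹ (z a) t * charProd b z l t := rfl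

theorem measurable_charProd (b : ℕ) (z : ℕ → ℂ) (l : List ℕ) : Measurable (charProd b z l) := by
  induction l with
  | nil => exact measurable_const
  | cons a l ih => exact (measurable_stepChar _ _).mul ih

variable [NeZero b]

theorem charProd_continuousWithinAt_Ioi (z : ℕ → ℂ) (l : List ℕ) (x : ℝ) :
    ContinuousWithinAt (charProd b z l) (Set.Ioi x) x := by
  induction l with
  | nil => exact continuousWithinAt_const
  | cons a l ih => exact (stepChar_continuousWithinAt_Ioi (inv_pow_pos b a) _ x).mul ih

theorem charProd_factorsThrough (z : ℕ → ℂ) (h : ∀ c ∈ l, c ≤ a) :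
    (charProd b z l).FactorsThrough fun t => ⌊t / ((b : ℝ) ^ a)⁻¹⌋ := fun s t hst => by
  have hfloor : ∀ c ≤ a, ∀ t : ℝ,
      ⌊t / ((b : ℝ) ^ c)⁻¹⌋ = ⌊t / ((b : ℝ) ^ a)⁻¹⌋ / (b ^ (a - c) : ℕ) := fun c hc t => by
    rw [← Int.floor_div_natCast, div_div, mul_comm _ ((b ^ (a - c) : ℕ) : ℝ),
      inv_pow_eq_mul_inv_pow hc]
  unfold charProd
  congr 1
  refine List.map_congr_left fun c hc => ?_
  simp only [stepChar, hfloor c (h c hc)] at hst ⊢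
  rw [hst]

variable (hroot : ∀ a, z a ^ b = 1)
include hroot

theorem norm_charProd (l : List ℕ) (t : ℝ) : ‖charProd b z l t‖ = 1 := by
  induction l with
  | nil => simp [charProd]
  | cons a l ih => rw [charProd_cons, norm_mul, norm_stepChar (norm_root hroot a), ih, one_mul]

theorem norm_charKernel (l' l : List ℕ) (t : ℝ) : ‖charKernel b z l' l t‖ = ‖iterInt b z l t‖ := by
  rw [charKernel, norm_mul, norm_charProd hroot, one_mul]

theorem measurable_charKernel (l' l : List ℕ) : Measurable (charKernel b z l' l) :=
  (measurable_charProd b z l').mul (continuous_iterInt hroot l).measurable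

theorem charKernel_continuousWithinAt_Ioi (l' l : List ℕ) (x : ℝ) :
    ContinuousWithinAt (charKernel b z l' l) (Set.Ioi x) x :=
  (charProd_continuousWithinAt_Ioi z l' x).mul (continuous_iterInt hroot l).continuousWithinAt

theorem intervalIntegrable_charKernel (l' l : List ℕ) (u v : ℝ) :
    IntervalIntegrable (charKernel b z l' l) volume u v :=
  ((continuous_iterInt hroot l).intervalIntegrable u v).mono_fun
    (measurable_charKernel hroot l' l).aestronglyMeasurable
    (.of_forall fun t => (norm_charKernel hroot l' l t).le)

theorem integral_charKernel (ha : 1 ≤ a) (hl' : ∀ c ∈ l', c < a) (hl : (a :: l).Pairwise (· < ·))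
    (hne : ∀ c ∈ a :: l, z c ≠ 1) {x : ℝ} (hx : 0 ≤ x) :
    ∫ t in 0..x, charKernel b z (a :: l') l t = charKernel b z l' (a :: l) x := by
  have hassoc : charKernel b z (a :: l') l = fun t =>
      charProd b z l' t * (stepChar ((b : ℝ) ^ a)⁻¹ (z a) t * iterInt b z l t) := by
    funext t
    rw [charKernel, charProd_cons]
    ring
  have hint := intervalIntegrable_charKernel hroot (a :: l') l
  rw [hassoc] at hint ⊢
  exact integral_mul_eq_mul_integral (inv_pow_pos b (a - 1))
    (charProd_factorsThrough z fun c hc => Nat.le_sub_one_of_lt (hl' c hc))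
    (intervalIntegrable_stepChar_mul_iterInt hroot a l) hint
    (iterInt_cons_mul_inv_pow hroot hne hl (Nat.sub_one_lt_of_lt ha)) hx

theorem charKernel_cons_one (ha : 1 ≤ a) (hl : (a :: l).Pairwise (· < ·))
    (hne : ∀ c ∈ a :: l, z c ≠ 1) : charKernel b z l' (a :: l) 1 = 0 := by
  have h := iterInt_cons_mul_inv_pow hroot hne hl (Nat.zero_lt_of_lt ha) 1
  rw [Nat.cast_one, one_mul, pow_zero, inv_one] at h
  rw [charKernel, h, mul_zero]

end CharKernel

/-! ### Digits and roots of unity -/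

section Digits

variable {b k a : ℕ}

/-- The root of unity `ω_b ^ (-κ)`, where `κ` is the digit of `k` at position `a`, the lowest
digit being at position `1`. -/
noncomputable def digitRoot (b k a : ℕ) : ℂ := conj (omega b) ^ (Nat.digits b k).getD (a - 1) 0

theorem pairwise_positions (b k : ℕ) : (positions b k).Pairwise (· > ·) := by
  unfold positions
  rw [List.pairwise_reverse, List.pairwise_map]
  exact (List.pairwise_lt_range.sublist List.filter_sublist).imp Nat.succ_lt_succ

theorem one_le_of_mem_positions (h : a ∈ positions b k) : 1 ≤ a := by
  simp only [positions, List.mem_reverse, List.mem_map] at h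
  obtain ⟨i, -, rfl⟩ := h
  exact i.succ_pos

theorem digit_ne_zero_of_mem_positions (h : a ∈ positions b k) :
    (Nat.digits b k).getD (a - 1) 0 ≠ 0 := by
  simp only [positions, List.mem_reverse, List.mem_map, List.mem_filter] at h
  obtain ⟨i, ⟨-, hi⟩, rfl⟩ := h
  simpa using hi

theorem getD_digits_lt (hb : 2 ≤ b) (k i : ℕ) : (Nat.digits b k).getD i 0 < b := by
  rw [Nat.getD_digits k i hb]
  exact Nat.mod_lt _ (by lia)

theorem nonempty_Icc_one_sub_one (hb : 2 ≤ b) : Nonempty (Finset.Icc 1 (b - 1)) :=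
  ⟨⟨1, Finset.mem_Icc.2 (by lia)⟩⟩

section Roots

variable [NeZero b]

theorem isPrimitiveRoot_conj_omega (b : ℕ) [NeZero b] : IsPrimitiveRoot (conj (omega b)) b :=
  (Complex.isPrimitiveRoot_exp b (NeZero.ne b)).map_of_injective (f := starRingEnd ℂ)
    star_injective

theorem digitRoot_pow_eq_one (k a : ℕ) : digitRoot b k a ^ b = 1 := by
  rw [digitRoot, pow_right_comm, (isPrimitiveRoot_conj_omega b).pow_eq_one, one_pow]

theorem digitRoot_ne_one (hb : 2 ≤ b) (h : a ∈ positions b k) : digitRoot b k a ≠ 1 :=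
  (isPrimitiveRoot_conj_omega b).pow_ne_one_of_pos_of_lt (digit_ne_zero_of_mem_positions h)
    (getD_digits_lt hb k _)

theorem norm_one_sub_le_mMax {ξ : ℂ} (hξ : ξ ^ b = 1) : ‖1 - ξ‖ ≤ mMax b := by
  obtain ⟨c, hc, rfl⟩ := (isPrimitiveRoot_conj_omega b).eq_pow_of_pow_eq_one hξ
  obtain rfl | h0 := eq_or_ne c 0
  · rw [pow_zero, sub_self, norm_zero]
    exact Real.iSup_nonneg fun _ => norm_nonneg _
  · exact le_ciSup (f := fun c : Finset.Icc 1 (b - 1) => ‖1 - conj (omega b) ^ (c : ℕ)‖)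
      (Set.finite_range _).bddAbove ⟨c, Finset.mem_Icc.2 (by lia)⟩

theorem mMin_le_norm_one_sub {ξ : ℂ} (hξ : ξ ^ b = 1) (hne : ξ ≠ 1) : mMin b ≤ ‖1 - ξ‖ := by
  obtain ⟨c, hc, rfl⟩ := (isPrimitiveRoot_conj_omega b).eq_pow_of_pow_eq_one hξ
  have h0 : c ≠ 0 := by rintro rfl; exact hne (pow_zero _)
  exact ciInf_le (f := fun c : Finset.Icc 1 (b - 1) => ‖1 - conj (omega b) ^ (c : ℕ)‖)
    (Set.finite_range _).bddBelow ⟨c, Finset.mem_Icc.2 (by lia)⟩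

theorem mMin_pos (hb : 2 ≤ b) : 0 < mMin b := by
  have := nonempty_Icc_one_sub_one hb
  obtain ⟨⟨c, hc⟩, h⟩ := exists_eq_ciInf_of_finite
    (f := fun c : Finset.Icc 1 (b - 1) => ‖1 - conj (omega b) ^ (c : ℕ)‖)
  rw [Finset.mem_Icc] at hc
  rw [mMin, ← h, norm_pos_iff, sub_ne_zero]
  exact ((isPrimitiveRoot_conj_omega b).pow_ne_one_of_pos_of_lt (by lia) (by lia)).symm

theorem mMax_le_two (hb : 2 ≤ b) : mMax b ≤ 2 := by
  have := nonempty_Icc_one_sub_one hb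
  have hnorm := (isPrimitiveRoot_conj_omega b).norm'_eq_one (NeZero.ne b)
  refine ciSup_le fun c => (norm_sub_le _ _).trans ?_
  rw [norm_one, norm_pow, hnorm, one_pow]
  norm_num

/- The average of `1 - ξ` over the `b`-th roots of unity `ξ` is `1`. -/
theorem one_le_mMax (hb : 2 ≤ b) : 1 ≤ mMax b := by
  have hω := isPrimitiveRoot_conj_omega b
  have hsum : ∑ c ∈ Finset.range b, (1 - conj (omega b) ^ c) = b := by
    simp [hω.geom_sum_eq_zero (by lia)]
  have hle : (b : ℝ) ≤ b * mMax b := by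
    calc (b : ℝ) = ‖∑ c ∈ Finset.range b, (1 - conj (omega b) ^ c)‖ := by simp [hsum]
      _ ≤ ∑ _c ∈ Finset.range b, mMax b := norm_sum_le_of_le _ fun c _ =>
          norm_one_sub_le_mMax (by rw [pow_right_comm, hω.pow_eq_one, one_pow])
      _ = b * mMax b := by simp
  exact one_le_of_le_mul_left₀ (by exact_mod_cast NeZero.pos b) hle

theorem norm_one_sub_digitRoot_zpow_le (k a : ℕ) (n : ℤ) :
    ‖1 - digitRoot b k a ^ n‖ ≤ mMax b :=
  norm_one_sub_le_mMax (by
    rw [← zpow_natCast, zpow_comm, zpow_natCast, digitRoot_pow_eq_one, one_zpow])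

theorem mMin_le_norm_one_sub_digitRoot (hb : 2 ≤ b) (h : a ∈ positions b k) :
    mMin b ≤ ‖1 - digitRoot b k a‖ :=
  mMin_le_norm_one_sub (digitRoot_pow_eq_one k a) (digitRoot_ne_one hb h)

theorem constC_eq_mul_sum (hb : 2 < b) (n : ℕ) :
    constC b n = mMin b * ∑ i ∈ Finset.range n, (mMax b / b) ^ i := by
  have hM : mMax b < b := (mMax_le_two hb.le).trans_lt (by exact_mod_cast hb)
  have hb0 : (b : ℝ) ≠ 0 := NeZero.ne _
  have hsub : (b : ℝ) - mMax b ≠ 0 := (sub_pos.2 hM).ne'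
  have hneg : mMax b - b ≠ 0 := (sub_neg.2 hM).ne
  rw [constC, geom_sum_eq (by rwa [Ne, div_eq_one_iff_eq hb0, ← sub_eq_zero]), div_sub_one hb0]
  field_simp
  ring

end Roots

theorem digitRoot_two (h : a ∈ positions 2 k) : digitRoot 2 k a = -1 :=
  (sq_eq_one_iff.1 (digitRoot_pow_eq_one k a)).resolve_left (digitRoot_ne_one le_rfl h)

theorem stepChar_digitRoot_eq [NeZero b] (k i : ℕ) {x : ℝ} (hx : 0 ≤ x) :
    stepChar ((b : ℝ) ^ (i + 1))⁻¹ (digitRoot b k (i + 1)) x =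
      conj (omega b) ^ ((Nat.digits b k).getD i 0 * (Real.digits x b i : ℕ)) := by
  have hdigit : (Real.digits x b i : ℕ) = ⌊x * (b : ℝ) ^ (i + 1)⌋₊ % b := rfl
  rw [stepChar, div_inv_eq_mul, ← Int.natCast_floor_eq_floor (by positivity), zpow_natCast,
    pow_eq_pow_mod _ (digitRoot_pow_eq_one k (i + 1)), digitRoot, ← pow_mul, hdigit,
    Nat.add_sub_cancel]

theorem conj_wal [NeZero b] (k : ℕ) {x : ℝ} (hx : 0 ≤ x) :
    conj (wal b k x) = charProd b (digitRoot b k) (positions b k) x := by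
  rw [wal, map_pow, ← Finset.prod_pow_eq_pow_sum, charProd, positions, List.map_reverse,
    List.prod_reverse, List.map_map, ← List.prod_toFinset _ (List.nodup_range.filter _),
    List.toFinset_filter, List.toFinset_range]
  simp only [Function.comp_apply, stepChar_digitRoot_eq k _ hx, decide_eq_true_eq]
  symm
  refine Finset.prod_filter_of_ne fun i _ hi hdigit => hi ?_
  rw [hdigit, zero_mul, pow_zero]

end Digits

/-! ### Kernels of the iterated integration by parts -/

section WalKernel

variable {b k α r : ℕ}

/-- The kernel obtained from `conj (wal b k)` by `r` integrations by parts, one for each of the `r`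
highest digits. -/
noncomputable def walKernel (b k r : ℕ) : ℝ → ℂ :=
  charKernel b (digitRoot b k) ((positions b k).drop r) ((positions b k).take r).reverse

theorem walKernel_zero [NeZero b] (k : ℕ) {x : ℝ} (hx : 0 ≤ x) :
    walKernel b k 0 x = conj (wal b k x) := by
  simp [conj_wal k hx, walKernel, charKernel, iterInt]

theorem mem_positions_of_mem_reverse_take {c : ℕ} (h : c ∈ ((positions b k).take r).reverse) :
    c ∈ positions b k :=
  List.mem_of_mem_take (List.mem_reverse.1 h)

theorem pairwise_reverse_take_positions (b k r : ℕ) :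
    ((positions b k).take r).reverse.Pairwise (· < ·) :=
  List.pairwise_reverse.2 ((pairwise_positions b k).sublist (List.take_sublist _ _))

theorem length_reverse_take_positions (b k r : ℕ) :
    ((positions b k).take r).reverse.length = min r (weight b k) := by
  rw [List.length_reverse, List.length_take, weight]

theorem sum_reverse_take_positions (hr : r = min α (weight b k)) :
    ((positions b k).take r).reverse.sum = mu b α k := by
  rw [List.sum_reverse, mu, hr, weight, ← List.take_eq_take_min]

theorem meanBound_reverse_take_positions (hr : r = min α (weight b k)) (m : ℝ) :
    meanBound b m ((positions b k).take r).reverse = (b : ℝ) ^ (-(mu b α k : ℤ)) / m ^ r := by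
  rw [meanBound, sum_reverse_take_positions hr, length_reverse_take_positions,
    min_eq_left (hr ▸ min_le_right _ _), zpow_neg, zpow_natCast, mul_inv, div_eq_mul_inv]

theorem norm_walKernel [NeZero b] (k r : ℕ) (x : ℝ) :
    ‖walKernel b k r x‖ = ‖iterInt b (digitRoot b k) ((positions b k).take r).reverse x‖ :=
  norm_charKernel (digitRoot_pow_eq_one k) _ _ x

theorem measurable_walKernel [NeZero b] (k r : ℕ) : Measurable (walKernel b k r) :=
  measurable_charKernel (digitRoot_pow_eq_one k) _ _

theorem integrableOn_walKernel [NeZero b] (k r : ℕ) :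
    IntegrableOn (walKernel b k r) (Set.Icc 0 1) :=
  (intervalIntegrable_iff_integrableOn_Icc_of_le zero_le_one).1
    (intervalIntegrable_charKernel (digitRoot_pow_eq_one k) _ _ 0 1)

theorem reverse_take_positions_eq_cons (hr : r < weight b k) :
    ((positions b k).take (r + 1)).reverse =
      (positions b k)[r] :: ((positions b k).take r).reverse := by
  rw [List.take_succ_eq_append_getElem hr, List.reverse_concat]

theorem digitRoot_ne_one_of_mem_reverse_take [NeZero b] (hb : 2 ≤ b) :
    ∀ c ∈ ((positions b k).take r).reverse, digitRoot b k c ≠ 1 :=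
  fun _ hc => digitRoot_ne_one hb (mem_positions_of_mem_reverse_take hc)

theorem integral_walKernel [NeZero b] (hb : 2 ≤ b) (hr : r < weight b k) {x : ℝ} (hx : 0 ≤ x) :
    ∫ t in 0..x, walKernel b k r t = walKernel b k (r + 1) x := by
  have hdrop := List.drop_eq_getElem_cons hr
  have hdecr := (pairwise_positions b k).sublist (List.drop_sublist r _)
  have htake := reverse_take_positions_eq_cons hr
  rw [hdrop, List.pairwise_cons] at hdecr
  rw [walKernel, hdrop, walKernel, htake]
  exact integral_charKernel (digitRoot_pow_eq_one k)
    (one_le_of_mem_positions (List.getElem_mem hr)) hdecr.1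
    (htake ▸ pairwise_reverse_take_positions b k (r + 1))
    (htake ▸ digitRoot_ne_one_of_mem_reverse_take hb) hx

theorem walKernel_succ_one [NeZero b] (hb : 2 ≤ b) (hr : r < weight b k) :
    walKernel b k (r + 1) 1 = 0 := by
  have htake := reverse_take_positions_eq_cons hr
  rw [walKernel, htake]
  exact charKernel_cons_one (digitRoot_pow_eq_one k)
    (one_le_of_mem_positions (List.getElem_mem hr))
    (htake ▸ pairwise_reverse_take_positions b k (r + 1))
    (htake ▸ digitRoot_ne_one_of_mem_reverse_take hb)

theorem norm_walKernel_le (hb : 2 < b) (hr : r = min α (weight b k)) (x : ℝ) :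
    ‖walKernel b k r x‖ ≤ (b : ℝ) ^ (-(mu b α k : ℤ)) / mMin b ^ r *
      (mMax b + constC b r) ^ min 1 (weight b k) := by
  have : NeZero b := ⟨by lia⟩
  rw [← meanBound_reverse_take_positions hr, constC_eq_mul_sum hb, norm_walKernel]
  obtain rfl | h0 := eq_or_ne r 0
  · simpa [iterInt, meanBound] using one_le_pow₀ (one_le_mMax hb.le)
  obtain ⟨q, rfl⟩ := Nat.exists_eq_add_one_of_ne_zero h0
  have hq : q < weight b k := by lia
  have hlen : ((positions b k).take q).reverse.length = q :=
    (length_reverse_take_positions b k q).trans (min_eq_left hq.le)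
  have hlt := pairwise_reverse_take_positions b k (q + 1)
  have hz : ∀ c ∈ ((positions b k).take (q + 1)).reverse, mMin b ≤ ‖1 - digitRoot b k c‖ :=
    fun c hc => mMin_le_norm_one_sub_digitRoot hb.le (mem_positions_of_mem_reverse_take hc)
  rw [reverse_take_positions_eq_cons hq] at hz hlt ⊢
  rw [min_eq_left (by lia), pow_one]
  simpa only [hlen] using norm_iterInt_cons_le (digitRoot_pow_eq_one k) (mMin_pos hb.le)
    (norm_one_sub_digitRoot_zpow_le k) hz hlt x

theorem two_rpow_eq_meanBound (hr : r = min α (weight 2 k)) :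
    (2 : ℝ) ^ (-(mu 2 α k : ℝ) - r) = meanBound 2 2 ((positions 2 k).take r).reverse := by
  rw [meanBound_reverse_take_positions hr, Real.rpow_sub two_pos, Real.rpow_natCast,
    ← Int.cast_natCast (mu 2 α k), ← Int.cast_neg, Real.rpow_intCast, Nat.cast_ofNat]

theorem norm_walKernel_two_le (hr : r = min α (weight 2 k)) (x : ℝ) :
    ‖walKernel 2 k r x‖ ≤ 2 ^ min 1 (weight 2 k) * (2 : ℝ) ^ (-(mu 2 α k : ℝ) - r) := by
  rw [two_rpow_eq_meanBound hr, norm_walKernel]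
  obtain rfl | h0 := eq_or_ne r 0
  · simpa [iterInt, meanBound] using one_le_pow₀ one_le_two
  obtain ⟨q, rfl⟩ := Nat.exists_eq_add_one_of_ne_zero h0
  have hq : q < weight 2 k := by lia
  have hlt := pairwise_reverse_take_positions 2 k (q + 1)
  have hz : ∀ c ∈ ((positions 2 k).take (q + 1)).reverse, digitRoot 2 k c = -1 :=
    fun c hc => digitRoot_two (mem_positions_of_mem_reverse_take hc)
  rw [reverse_take_positions_eq_cons hq] at hz hlt ⊢
  rw [min_eq_left (by lia), pow_one]
  exact norm_iterInt_cons_two_le (digitRoot_pow_eq_one k) hz hlt x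

theorem integral_norm_walKernel_two (hr : r = min α (weight 2 k)) :
    ∫ t in 0..1, ‖walKernel 2 k r t‖ = (2 : ℝ) ^ (-(mu 2 α k : ℝ) - r) := by
  have hpos : ∀ c ∈ ((positions 2 k).take r).reverse, 0 < c := fun c hc =>
    one_le_of_mem_positions (mem_positions_of_mem_reverse_take hc)
  simpa [two_rpow_eq_meanBound hr, norm_walKernel] using
    integral_norm_iterInt_two (a := 0) (digitRoot_pow_eq_one k)
      (fun c hc => digitRoot_two (mem_positions_of_mem_reverse_take hc))
      (List.pairwise_cons.2 ⟨hpos, pairwise_reverse_take_positions 2 k r⟩)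

end WalKernel

section ByParts

/-- Integration by parts on `[0, 1]` turns `φ` into `Φ`, without boundary terms. -/
def ByParts (φ Φ : ℝ → ℂ) : Prop :=
  ∀ g : ℝ → ℝ, DifferentiableOn ℝ g (Set.Icc 0 1) →
    ContinuousOn (derivWithin g (Set.Icc 0 1)) (Set.Icc 0 1) →
    ∫ x in 0..1, (g x : ℂ) * φ x =
      -∫ x in 0..1, ((derivWithin g (Set.Icc 0 1) x : ℝ) : ℂ) * Φ x

theorem byParts_of_primitive {φ Φ : ℝ → ℂ} (hmeas : Measurable φ)
    (hint : ∀ u v, IntervalIntegrable φ volume u v)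
    (hcont : ∀ x, ContinuousWithinAt φ (Set.Ioi x) x)
    (hprim : ∀ x, 0 ≤ x → ∫ t in 0..x, φ t = Φ x) (hone : Φ 1 = 0) : ByParts φ Φ := by
  intro g hg hg'
  have huIcc : Set.uIcc (0 : ℝ) 1 = Set.Icc 0 1 := Set.uIcc_of_le zero_le_one
  have hparts := intervalIntegral.integral_mul_deriv_eq_deriv_mul_of_hasDeriv_right
    (a := 0) (b := 1) (u := fun x => (g x : ℂ))
    (u' := fun x => ((derivWithin g (Set.Icc 0 1) x : ℝ) : ℂ))
    (v := fun x => ∫ t in 0..x, φ t) (v' := φ)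
    (huIcc ▸ Complex.continuous_ofReal.comp_continuousOn hg.continuousOn)
    (intervalIntegral.continuous_primitive hint 0).continuousOn ?deriv_left ?deriv_right
    ((Complex.continuous_ofReal.comp_continuousOn hg').intervalIntegrable_of_Icc zero_le_one)
    (hint 0 1)
  case deriv_left =>
    intro x hx
    rw [min_eq_left zero_le_one, max_eq_right zero_le_one] at hx
    exact ((hg x (Set.Ioo_subset_Icc_self hx)).hasDerivWithinAt.hasDerivAt
      (Icc_mem_nhds hx.1 hx.2)).ofReal_comp.hasDerivWithinAt
  case deriv_right =>
    intro x _
    exact (intervalIntegral.integral_hasDerivWithinAt_right (hint 0 x) (s := Set.Ici x)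
      (t := Set.Ioi x) hmeas.stronglyMeasurable.stronglyMeasurableAtFilter (hcont x)).mono
      Set.Ioi_subset_Ici_self
  rw [hparts, hprim 1 zero_le_one, hone, intervalIntegral.integral_same, mul_zero, mul_zero,
    sub_zero, zero_sub, neg_inj]
  refine intervalIntegral.integral_congr_Ioo_of_le zero_le_one fun x hx => ?_
  simp only [hprim x hx.1.le]

theorem byParts_walKernel {b : ℕ} [NeZero b] (hb : 2 ≤ b) {k r : ℕ} (hr : r < weight b k) :
    ByParts (walKernel b k r) (walKernel b k (r + 1)) :=
  have hroot := digitRoot_pow_eq_one (b := b) k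
  byParts_of_primitive (measurable_walKernel k r)
    (intervalIntegrable_charKernel hroot _ _) (charKernel_continuousWithinAt_Ioi hroot _ _)
    (fun _ hx => integral_walKernel hb hr hx) (walKernel_succ_one hb hr)

end ByParts

/-! ### Integration over the cube -/

section Cube

variable {s : ℕ} {g : (Fin s → ℝ) → ℝ}

theorem isCompact_cube (s : ℕ) : IsCompact (cube s) := isCompact_univ_pi fun _ => isCompact_Icc

theorem measurableSet_cube (s : ℕ) : MeasurableSet (cube s) := (isCompact_cube s).measurableSet

theorem volume_restrict_cube (s : ℕ) :
    volume.restrict (cube s) = Measure.pi fun _ => volume.restrict (Set.Icc (0 : ℝ) 1) := by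
  rw [cube, volume_pi, Measure.restrict_pi_pi]

theorem memLp_restrict_cube (hg : ContinuousOn g (cube s)) (p : ℝ≥0∞) :
    MemLp g p (volume.restrict (cube s)) := by
  obtain ⟨C, hC⟩ := (isCompact_cube s).exists_bound_of_continuousOn hg
  have : IsFiniteMeasure (volume.restrict (cube s)) :=
    isFiniteMeasure_restrict.2 (isCompact_cube s).measure_lt_top.ne
  exact .of_bound (hg.aestronglyMeasurable (measurableSet_cube s)) C
    (ae_restrict_of_forall_mem (measurableSet_cube s) hC)

theorem integrableOn_cube_prod {φ : Fin s → ℝ → ℂ}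
    (hφ : ∀ i, IntegrableOn (φ i) (Set.Icc 0 1)) :
    IntegrableOn (fun x => ∏ i, φ i (x i)) (cube s) := by
  rw [IntegrableOn, volume_restrict_cube]
  exact Integrable.fintype_prod hφ

theorem integrableOn_cube_mul (hg : ContinuousOn g (cube s)) {K : (Fin s → ℝ) → ℂ}
    (hK : IntegrableOn K (cube s)) : IntegrableOn (fun x => (g x : ℂ) * K x) (cube s) :=
  hK.continuousOn_mul (Complex.continuous_ofReal.comp_continuousOn hg) (isCompact_cube s)

theorem integral_cube_prod (w : Fin s → ℝ → ℝ) :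
    ∫ x in cube s, ∏ i, w i (x i) = ∏ i, ∫ t in 0..1, w i t := by
  rw [volume_restrict_cube, integral_fintype_prod_eq_prod]
  simp only [intervalIntegral.integral_of_le zero_le_one, integral_Icc_eq_integral_Ioc]

theorem insertNth_mem_cube (j : Fin (s + 1)) {t : ℝ} {y : Fin s → ℝ} :
    j.insertNth (α := fun _ => ℝ) t y ∈ cube (s + 1) ↔ t ∈ Set.Icc (0 : ℝ) 1 ∧ y ∈ cube s := by
  simp only [cube, Set.mem_univ_pi, j.forall_iff_succAbove, Fin.insertNth_apply_same,
    Fin.insertNth_apply_succAbove]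

theorem prod_insertNth (j : Fin (s + 1)) (φ : Fin (s + 1) → ℝ → ℂ) (t : ℝ) (y : Fin s → ℝ) :
    ∏ i, φ i (j.insertNth (α := fun _ => ℝ) t y i) = φ j t * ∏ i, φ (j.succAbove i) (y i) := by
  simp only [Fin.prod_univ_succAbove _ j, Fin.insertNth_apply_same, Fin.insertNth_apply_succAbove]

theorem integral_cube_succ (j : Fin (s + 1)) {F : (Fin (s + 1) → ℝ) → ℂ}
    (hF : IntegrableOn F (cube (s + 1))) :
    ∫ x in cube (s + 1), F x =
      ∫ y in cube s, ∫ t in 0..1, F (j.insertNth (α := fun _ => ℝ) t y) := by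
  set e : ℝ × (Fin s → ℝ) ≃ᵐ (Fin (s + 1) → ℝ) :=
    (MeasurableEquiv.piFinSuccAbove (fun _ => ℝ) j).symm
  have he : MeasurePreserving e :=
    (volume_preserving_piFinSuccAbove (fun _ : Fin (s + 1) => ℝ) j).symm _
  have hpre : e ⁻¹' cube (s + 1) = Set.Icc (0 : ℝ) 1 ×ˢ cube s :=
    Set.ext fun _ => insertNth_mem_cube j
  have hFe : IntegrableOn (F ∘ e) (Set.Icc (0 : ℝ) 1 ×ˢ cube s) :=
    hpre ▸ (he.integrableOn_comp_preimage e.measurableEmbedding).2 hF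
  rw [IntegrableOn, Measure.volume_eq_prod, ← Measure.prod_restrict] at hFe
  rw [← he.setIntegral_preimage_emb e.measurableEmbedding, hpre, Measure.volume_eq_prod,
    ← Measure.prod_restrict]
  refine (integral_prod_symm _ hFe).trans ?_
  simp only [intervalIntegral.integral_of_le zero_le_one, ← integral_Icc_eq_integral_Ioc]
  rfl

theorem partialDeriv_insertNth (j : Fin (s + 1)) (g : (Fin (s + 1) → ℝ) → ℝ) (t : ℝ)
    (y : Fin s → ℝ) : partialDeriv j g (j.insertNth (α := fun _ => ℝ) t y) =
      derivWithin (fun t => g (j.insertNth (α := fun _ => ℝ) t y)) (Set.Icc 0 1) t := by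
  simp only [partialDeriv, Fin.update_insertNth, Fin.insertNth_apply_same]

theorem ByParts.integral_insertNth {φ Φ : ℝ → ℂ} (hparts : ByParts φ Φ) (j : Fin (s + 1))
    {g : (Fin (s + 1) → ℝ) → ℝ} (hg' : ContinuousOn (partialDeriv j g) (cube (s + 1)))
    (hd : ∀ x ∈ cube (s + 1), DifferentiableWithinAt ℝ (fun t => g (Function.update x j t))
      (Set.Icc 0 1) (x j)) {y : Fin s → ℝ} (hy : y ∈ cube s) :
    ∫ t in 0..1, (g (j.insertNth (α := fun _ => ℝ) t y) : ℂ) * φ t =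
      -∫ t in 0..1, (partialDeriv j g (j.insertNth (α := fun _ => ℝ) t y) : ℂ) * Φ t := by
  have hmem : ∀ t ∈ Set.Icc (0 : ℝ) 1, j.insertNth (α := fun _ => ℝ) t y ∈ cube (s + 1) :=
    fun t ht => (insertNth_mem_cube j).2 ⟨ht, hy⟩
  have hline : Continuous fun t : ℝ => j.insertNth (α := fun _ => ℝ) t y := by fun_prop
  have hslice := hg'.comp hline.continuousOn hmem
  simp only [Function.comp_def, partialDeriv_insertNth] at hslice ⊢
  refine hparts _ (fun t ht => ?_) hslice
  simpa only [Fin.update_insertNth, Fin.insertNth_apply_same] using hd _ (hmem t ht)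

theorem integral_cube_byParts (j : Fin s) (hg : ContinuousOn g (cube s))
    (hg' : ContinuousOn (partialDeriv j g) (cube s))
    (hd : ∀ x ∈ cube s, DifferentiableWithinAt ℝ (fun t => g (Function.update x j t))
      (Set.Icc 0 1) (x j))
    {φ : Fin s → ℝ → ℂ} (hφ : ∀ i, IntegrableOn (φ i) (Set.Icc 0 1)) {Φ : ℝ → ℂ}
    (hΦ : IntegrableOn Φ (Set.Icc 0 1)) (hparts : ByParts (φ j) Φ) :
    ∫ x in cube s, (g x : ℂ) * ∏ i, φ i (x i) =
      -∫ x in cube s, (partialDeriv j g x : ℂ) * ∏ i, Function.update φ j Φ i (x i) := by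
  obtain ⟨s, rfl⟩ : ∃ m, s = m + 1 := Nat.exists_eq_add_one.2 j.pos
  have hφ' : ∀ i, IntegrableOn (Function.update φ j Φ i) (Set.Icc 0 1) :=
    (Function.forall_update_iff φ fun _ ψ => IntegrableOn ψ (Set.Icc 0 1)).2
      ⟨hΦ, fun i _ => hφ i⟩
  rw [integral_cube_succ j (integrableOn_cube_mul hg (integrableOn_cube_prod hφ)),
    integral_cube_succ j (integrableOn_cube_mul hg' (integrableOn_cube_prod hφ')), ← integral_neg]
  refine setIntegral_congr_fun (measurableSet_cube s) fun y hy => ?_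
  simp only [prod_insertNth, Function.update_self, Function.update_of_ne (Fin.succAbove_ne j _),
    ← mul_assoc, intervalIntegral.integral_mul_const]
  rw [hparts.integral_insertNth j hg' hd hy, neg_mul]

end Cube

section MixedPartial

variable {s : ℕ} {n : Fin s → ℕ} {j : Fin s}

theorem foldr_iterate_update {β : Type*} (D : Fin s → β → β) (h0 : ∀ i < j, n i = 0) (f : β)
    {l : List (Fin s)} (hl : l.Pairwise (· < ·)) (hj : j ∈ l) :
    l.foldr (fun i => (D i)^[Function.update n j (n j + 1) i]) f =
      D j (l.foldr (fun i => (D i)^[n i]) f) := by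
  induction l with
  | nil => simp at hj
  | cons a l ih =>
    rw [List.pairwise_cons] at hl
    rw [List.foldr_cons, List.foldr_cons]
    obtain rfl | ha := eq_or_ne a j
    · have htail : l.foldr (fun i => (D i)^[Function.update n a (n a + 1) i]) f =
          l.foldr (fun i => (D i)^[n i]) f := List.foldr_ext _ _ _ fun i hi _ => by
        rw [Function.update_of_ne (hl.1 i hi).ne']
      rw [htail, Function.update_self, Function.iterate_succ_apply']
    · have hjl : j ∈ l := (List.mem_cons.1 hj).resolve_left ha.symm
      rw [Function.update_of_ne ha, h0 a (hl.1 j hjl), ih hl.2 hjl, Function.iterate_zero_apply,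
        Function.iterate_zero_apply]

theorem mixedPartial_update (h0 : ∀ i < j, n i = 0) (f : (Fin s → ℝ) → ℝ) :
    mixedPartial (Function.update n j (n j + 1)) f = partialDeriv j (mixedPartial n f) :=
  foldr_iterate_update partialDeriv h0 f (List.pairwise_lt_finRange s) (List.mem_finRange j)

theorem mixedPartial_zero (f : (Fin s → ℝ) → ℝ) : mixedPartial 0 f = f := by
  simp [mixedPartial]

theorem pi_nat_induction {motive : (Fin s → ℕ) → Prop} (zero : motive 0)
    (update : ∀ n j, (∀ i < j, n i = 0) → motive n → motive (Function.update n j (n j + 1)))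
    (n : Fin s → ℕ) : motive n := by
  induction hN : ∑ i, n i generalizing n with
  | zero =>
    obtain rfl : n = 0 := funext fun i => Finset.sum_eq_zero_iff.1 hN i (Finset.mem_univ i)
    exact zero
  | succ N ih =>
    have hne : {j | n j ≠ 0}.Nonempty := by
      by_contra! h
      have hzero : ∀ i, n i = 0 := by simpa [Set.eq_empty_iff_forall_notMem] using h
      simp [hzero] at hN
    obtain ⟨j, hj, hmin⟩ := wellFounded_lt.has_min _ hne
    obtain ⟨r, hr⟩ := Nat.exists_eq_add_one_of_ne_zero hj
    have hn : n = Function.update (Function.update n j r) j (Function.update n j r j + 1) := by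
      simp [← hr]
    rw [hn]
    refine update _ j (fun i hi => ?_) (ih _ ?_)
    · rw [Function.update_of_ne hi.ne]
      exact not_not.1 fun h => hmin i h hi
    · rw [Finset.sum_update_of_mem (Finset.mem_univ j)]
      rw [Finset.sum_eq_add_sum_sdiff_singleton_of_mem (Finset.mem_univ j), hr] at hN
      lia

variable {b : ℕ} [NeZero b] {k α : Fin s → ℕ} {f : (Fin s → ℝ) → ℝ}

theorem walshCoeff_eq_integral_cube (k : Fin s → ℕ) (f : (Fin s → ℝ) → ℝ) :
    walshCoeff b (fun x => (f x : ℂ)) k =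
      ∫ x in cube s, (f x : ℂ) * ∏ i, walKernel b (k i) 0 (x i) := by
  have hae : Set.univ.pi (fun _ : Fin s => Set.Ico (0 : ℝ) 1) =ᵐ[volume] cube s :=
    Measure.pi_Ico_ae_eq_pi_Icc
  rw [walshCoeff, setIntegral_congr_set hae]
  refine setIntegral_congr_fun (measurableSet_cube s) fun x hx => ?_
  simp only [walMulti, map_prod, fun i => walKernel_zero (b := b) (k i) (hx i trivial).1]

theorem integral_mixedPartial_update (hb : 2 ≤ b) (hf : HasContMixedPartials α f)
    (h0 : ∀ i < j, n i = 0) (hα : Function.update n j (n j + 1) ≤ α) (hw : n j < weight b (k j)) :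
    ∫ x in cube s, (mixedPartial (Function.update n j (n j + 1)) f x : ℂ) *
        ∏ i, walKernel b (k i) (Function.update n j (n j + 1) i) (x i) =
      -∫ x in cube s, (mixedPartial n f x : ℂ) * ∏ i, walKernel b (k i) (n i) (x i) := by
  have hkernel : (fun i => walKernel b (k i) (Function.update n j (n j + 1) i)) =
      Function.update (fun i => walKernel b (k i) (n i)) j (walKernel b (k j) (n j + 1)) := by
    funext i
    exact Function.apply_update (fun i => walKernel b (k i)) n j _ i
  have hnα : n ≤ α := (le_update_self_iff.2 (Nat.le_succ _)).trans hα
  obtain ⟨hcont, hdiff⟩ := hf n hnα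
  have hcont' := (hf _ hα).1
  rw [mixedPartial_update h0] at hcont' ⊢
  have hlt : n j < α j := (Function.update_self j (n j + 1) n).symm.trans_le (hα j)
  rw [integral_cube_byParts j hcont hcont' (hdiff j h0 hlt)
    (fun i => integrableOn_walKernel (k i) (n i)) (integrableOn_walKernel (k j) (n j + 1))
    (byParts_walKernel hb hw), neg_neg, ← hkernel]

theorem norm_walshCoeff_eq (hb : 2 ≤ b) (hf : HasContMixedPartials α f) (hα : n ≤ α)
    (hw : ∀ j, n j ≤ weight b (k j)) :
    ‖walshCoeff b (fun x => (f x : ℂ)) k‖ =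
      ‖∫ x in cube s, (mixedPartial n f x : ℂ) * ∏ i, walKernel b (k i) (n i) (x i)‖ := by
  induction n using pi_nat_induction with
  | zero => simp only [mixedPartial_zero, walshCoeff_eq_integral_cube, Pi.zero_apply]
  | update n j h0 ih =>
    have hle : n ≤ Function.update n j (n j + 1) :=
      le_update_self_iff.2 (Nat.le_succ _)
    have hwj := hw j
    rw [Function.update_self] at hwj
    rw [integral_mixedPartial_update hb hf h0 hα hwj, norm_neg,
      ih (hle.trans hα) fun i => (hle i).trans (hw i)]

end MixedPartial

/-! ### The weighted Hölder inequality -/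

section Holder

variable {X 𝕜 E : Type*} [MeasurableSpace X] {μ : Measure X} [NormedField 𝕜] [NormedAddCommGroup E]
  [NormedSpace ℝ E] [NormedSpace 𝕜 E] {g : X → 𝕜} {K : X → E} {p : ℝ≥0∞}

/- Hölder's inequality for `g` and the constant `1`, with respect to the measure `‖K‖ μ ≤ A μ`. -/
theorem enorm_integral_smul_le (hg : AEStronglyMeasurable g μ) (hK : AEStronglyMeasurable K μ)
    {A : ℝ≥0∞} (hA : ∀ᵐ x ∂μ, ‖K x‖ₑ ≤ A) (hp : 1 ≤ p) :
    ‖∫ x, g x • K x ∂μ‖ₑ ≤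
      A ^ (p⁻¹).toReal * eLpNorm g p μ * (∫⁻ x, ‖K x‖ₑ ∂μ) ^ (1 - (p⁻¹).toReal) := by
  set ν := μ.withDensity fun x => ‖K x‖ₑ with hν
  have hνμ : ν ≤ A • μ := by
    rw [hν, ← withDensity_const]
    exact withDensity_mono hA
  have hmass : ν Set.univ = ∫⁻ x, ‖K x‖ₑ ∂μ := by
    rw [hν, withDensity_apply _ MeasurableSet.univ, Measure.restrict_univ]
  have hscale := (eLpNorm_mono_measure g hνμ).trans (eLpNorm_smul_measure_le A g p μ)
  calc ‖∫ x, g x • K x ∂μ‖ₑ ≤ ∫⁻ x, ‖g x • K x‖ₑ ∂μ := enorm_integral_le_lintegral_enorm _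
    _ = eLpNorm g 1 ν := by
      rw [eLpNorm_one_eq_lintegral_enorm, hν,
        lintegral_withDensity_eq_lintegral_mul₀ hK.enorm hg.enorm]
      simp only [Pi.mul_apply, enorm_smul, mul_comm]
    _ ≤ eLpNorm g p ν * ν Set.univ ^ (1 / (1 : ℝ≥0∞).toReal - 1 / p.toReal) :=
      eLpNorm_le_eLpNorm_mul_rpow_measure_univ hp
        (hg.mono_ac (withDensity_absolutelyContinuous _ _))
    _ = eLpNorm g p ν * (∫⁻ x, ‖K x‖ₑ ∂μ) ^ (1 - (p⁻¹).toReal) := by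
      rw [hmass, ENNReal.toReal_one, one_div_one, one_div, ENNReal.toReal_inv]
    _ ≤ A ^ (p⁻¹).toReal * eLpNorm g p μ * (∫⁻ x, ‖K x‖ₑ ∂μ) ^ (1 - (p⁻¹).toReal) := by
      rw [one_div, smul_eq_mul] at hscale
      gcongr

theorem norm_integral_smul_le (hg : MemLp g p μ) (hK : Integrable K μ) {A : ℝ} (hA0 : 0 ≤ A)
    (hA : ∀ᵐ x ∂μ, ‖K x‖ ≤ A) (hp : 1 ≤ p) :
    ‖∫ x, g x • K x ∂μ‖ ≤ (eLpNorm g p μ).toReal *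
      (A ^ (p⁻¹).toReal * (∫ x, ‖K x‖ ∂μ) ^ (1 - (p⁻¹).toReal)) := by
  have hexp : 0 ≤ 1 - (p⁻¹).toReal :=
    sub_nonneg.2 (ENNReal.toReal_le_of_le_ofReal zero_le_one (by simpa using hp))
  have hI : 0 ≤ ∫ x, ‖K x‖ ∂μ := integral_nonneg fun _ => norm_nonneg _
  have hA' : ∀ᵐ x ∂μ, ‖K x‖ₑ ≤ ENNReal.ofReal A := by
    filter_upwards [hA] with x hx
    rw [← ofReal_norm]
    exact ENNReal.ofReal_le_ofReal hx
  have h := enorm_integral_smul_le hg.aestronglyMeasurable hK.aestronglyMeasurable hA' hp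
  rw [← ofReal_integral_norm_eq_lintegral_enorm hK,
    ENNReal.ofReal_rpow_of_nonneg hA0 ENNReal.toReal_nonneg,
    ENNReal.ofReal_rpow_of_nonneg hI hexp, ← ENNReal.ofReal_toReal hg.eLpNorm_ne_top,
    ← ENNReal.ofReal_mul (by positivity), ← ENNReal.ofReal_mul (by positivity),
    ← ofReal_norm, ENNReal.ofReal_le_ofReal_iff (by positivity)] at h
  exact h.trans_eq (by ring)

end Holder

section Bounds

variable {s : ℕ} {g : (Fin s → ℝ) → ℝ}

theorem norm_integral_cube_mul_prod_le {p : ℝ≥0∞} (hp : 1 ≤ p) (hg : ContinuousOn g (cube s))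
    {φ : Fin s → ℝ → ℂ} (hφ : ∀ i, IntegrableOn (φ i) (Set.Icc 0 1)) {A : Fin s → ℝ}
    (hA : ∀ i x, ‖φ i x‖ ≤ A i) :
    ‖∫ x in cube s, (g x : ℂ) * ∏ i, φ i (x i)‖ ≤ cubeNorm p g *
      ∏ i, (A i ^ (p⁻¹).toReal * (∫ t in 0..1, ‖φ i t‖) ^ (1 - (p⁻¹).toReal)) := by
  have hA0 : ∀ i, 0 ≤ A i := fun i => (norm_nonneg _).trans (hA i 0)
  have hI : ∀ i, 0 ≤ ∫ t in 0..1, ‖φ i t‖ := fun i =>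
    intervalIntegral.integral_nonneg zero_le_one fun _ _ => norm_nonneg _
  have hbound : ∀ x : Fin s → ℝ, ‖∏ i, φ i (x i)‖ ≤ ∏ i, A i := fun x => by
    rw [norm_prod]
    exact Finset.prod_le_prod (fun _ _ => norm_nonneg _) fun i _ => hA i (x i)
  have h := norm_integral_smul_le (memLp_restrict_cube hg p) (integrableOn_cube_prod hφ)
    (Finset.prod_nonneg fun i _ => hA0 i) (.of_forall hbound) hp
  simp only [Complex.real_smul, norm_prod, integral_cube_prod fun i t => ‖φ i t‖] at h
  rwa [← Real.finsetProd_rpow _ _ fun i _ => hA0 i, ← Real.finsetProd_rpow _ _ fun i _ => hI i,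
    ← Finset.prod_mul_distrib] at h

variable {k α n : Fin s → ℕ}

theorem prod_rpow_norm_walKernel_two (hn : ∀ j, n j = min (α j) (weight 2 (k j))) (θ : ℝ) :
    ∏ j, ((2 ^ min 1 (weight 2 (k j)) * (2 : ℝ) ^ (-(mu 2 (α j) (k j) : ℝ) - n j)) ^ θ *
        (∫ t in 0..1, ‖walKernel 2 (k j) (n j) t‖) ^ (1 - θ)) =
      ∏ j, (2 : ℝ) ^ (-(mu 2 (α j) (k j) : ℝ) - n j + (min 1 (weight 2 (k j)) : ℕ) * θ) := by
  refine Finset.prod_congr rfl fun j _ => ?_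
  rw [integral_norm_walKernel_two (hn j), ← Real.rpow_natCast, ← Real.rpow_add two_pos,
    ← Real.rpow_mul two_pos.le, ← Real.rpow_mul two_pos.le, ← Real.rpow_add two_pos]
  ring_nf

end Bounds

end Walsh

theorem mainTheorem3 {s : ℕ} (b : ℕ) [NeZero b] (hb : 2 ≤ b) (k α n : Fin s → ℕ)
    (hn : ∀ j, n j = min (α j) (Walsh.weight b (k j)))
    (f : (Fin s → ℝ) → ℝ) (hf : Walsh.HasContMixedPartials α f) :
    (2 < b →
      ‖Walsh.walshCoeff b (fun x => (f x : ℂ)) k‖ ≤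
        Walsh.cubeNorm 1 (Walsh.mixedPartial n f) *
          ∏ j, ((b : ℝ) ^ (-(Walsh.mu b (α j) (k j) : ℤ)) / Walsh.mMin b ^ n j *
            (Walsh.mMax b + Walsh.constC b (n j)) ^ min 1 (Walsh.weight b (k j)))) ∧
    (b = 2 → ∀ p : ℝ≥0∞, 1 ≤ p →
      ‖Walsh.walshCoeff b (fun x => (f x : ℂ)) k‖ ≤
        Walsh.cubeNorm p (Walsh.mixedPartial n f) *
          ∏ j, (2 : ℝ) ^ (-(Walsh.mu b (α j) (k j) : ℝ) - (n j : ℝ) +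
            (min 1 (Walsh.weight b (k j)) : ℕ) * (p⁻¹).toReal)) := by
  have hα : n ≤ α := fun j => (hn j).trans_le (min_le_left _ _)
  have hcont := (hf n hα).1
  have hint := fun j => Walsh.integrableOn_walKernel (b := b) (k j) (n j)
  rw [Walsh.norm_walshCoeff_eq hb hf hα fun j => (hn j).trans_le (min_le_right _ _)]
  constructor
  · intro hb2
    simpa using Walsh.norm_integral_cube_mul_prod_le le_rfl hcont hint
      fun j => Walsh.norm_walKernel_le hb2 (hn j)
  · rintro rfl p hp
    rw [← Walsh.prod_rpow_norm_walKernel_two hn]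
    exact Walsh.norm_integral_cube_mul_prod_le hp hcont hint
      fun j => Walsh.norm_walKernel_two_le (hn j)
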